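/- Let $F=(V,C)$ denote a CNF formula, where $V$ is a finite set of variables and $C$ is a finite multiset of non-empty clauses (sets of literals over $V$). Let $m=|C|$ be the number of clauses, counted with multiplicity, and let $\mathrm{sat}(F)$ be the maximum number of clauses of $C$ (counted with multiplicity) that are simultaneously satisfied by a truth assignment $V\to\{\text{true},\text{false}\}$. The parameterized problem SAT-A$(m/2)$ has as instances the pairs $(F,k)$, where $F$ is a CNF formula with $m$ clauses and the parameter $k$ is a nonnegative integer; $(F,k)$ is a yes-instance if and only if $\mathrm{sat}(F)\ge m/2+k$. **Theorem.** SAT-A$(m/2)$ has a proper kernel with at most $4k$ variables and at most $(2\sqrt5+4)k\le 8.473k$ clauses. That is, there is a polynomial-time algorithm that maps every instance $(F,k)$ of SAT-A$(m/2)$ to an instance $(F',k')$ of SAT-A$(m/2)$ such that 1. $(F,k)$ is a yes-instance if and only if $(F',k')$ is a yes-instance; 2. $k'\le k$; 3. the size of (the encoding of) $F'$ is at most $g(k)$ for some function $g:\mathbb N\to\mathbb N$; 4. $F'$ has at most $4k$ variables and at most $(2\sqrt5+4)k$ clauses, counted with multiplicity; and $(2\sqrt5+4)k\le 8.473k$ for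 every $k$. -/

import Mathlib

namespace SATKernel

/-! ### Computation model

Programs working on finite binary trees (Lisp-like data), with an explicit running time. Every
elementary step is charged one unit plus the size of the whole tree it works on, so each step can
be carried out by a Turing machine in time polynomial in its charge, and conversely a Turing
machine with its tapes stored as lists is simulated with polynomial overhead. Polynomial time in
this model is therefore polynomial time in the usual sense. -/

/-- Data: finite binary trees. A list is stored as nested `cons` cells ending in `nil`. -/
inductive Data : Type
  | nil : Data
  | cons (a b : Data) : Data

namespace Data

/-- Size of a tree: the number of its nodes. -/
def size : Data → ℕ
  | nil => 1
  | cons a b => size a + size b + 1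

/-- First component of a pair; `nil` on `nil`. -/
def head : Data → Data
  | nil => nil
  | cons a _ => a

/-- Second component of a pair; `nil` on `nil`. -/
def tail : Data → Data
  | nil => nil
  | cons _ b => b

/-- A truth value as data. -/
def ofBool : Bool → Data
  | false => nil
  | true => cons nil nil

/-- A list of data items as one data item. -/
def ofList : List Data → Data
  | [] => nil
  | a :: l => cons a (ofList l)

/-- A natural number in unary, as a list of `n` marks. -/
def ofUnary (n : ℕ) : Data := ofList (List.replicate n nil)

/-- A natural number in binary, as the list of its binary digits, least significant first. -/
def ofNat (n : ℕ) : Data := ofList (n.bits.map ofBool)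

end Data

/-- Programs, each of which transforms one piece of data. -/
inductive Prog : Type
  /-- return the input -/
  | id : Prog
  /-- return `nil` -/
  | nil : Prog
  /-- return the first component -/
  | head : Prog
  /-- return the second component -/
  | tail : Prog
  /-- run both programs on the input and pair their results -/
  | cons (p q : Prog) : Prog
  /-- run `p`, then run `q` on its result -/
  | seq (p q : Prog) : Prog
  /-- run the test `c` on the input; run `p` on the input if the result is not `nil`, else `q` -/
  | ite (c p q : Prog) : Prog
  /-- as long as the test `c` on the current data does not give `nil`, apply `p` to the data -/
  | loop (c p : Prog) : Prog

/-- `Runs p v w t`: started on the input `v`, the program `p` halts with output `w` at the total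
cost (running time) `t`. -/
inductive Runs : Prog → Data → Data → ℕ → Prop
  | id (v : Data) : Runs .id v v (v.size + 1)
  | nil (v : Data) : Runs .nil v .nil (v.size + 1)
  | head (v : Data) : Runs .head v v.head (v.size + 1)
  | tail (v : Data) : Runs .tail v v.tail (v.size + 1)
  | cons {p q : Prog} {v a b : Data} {s t : ℕ} (hp : Runs p v a s) (hq : Runs q v b t) :
      Runs (.cons p q) v (.cons a b) (s + t + v.size + 1)
  | seq {p q : Prog} {v w u : Data} {s t : ℕ} (hp : Runs p v w s) (hq : Runs q w u t) :
      Runs (.seq p q) v u (s + t + v.size + 1)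
  | ite_true {c p q : Prog} {v a b w : Data} {s t : ℕ} (hc : Runs c v (.cons a b) s)
      (hp : Runs p v w t) : Runs (.ite c p q) v w (s + t + v.size + 1)
  | ite_false {c p q : Prog} {v w : Data} {s t : ℕ} (hc : Runs c v .nil s)
      (hq : Runs q v w t) : Runs (.ite c p q) v w (s + t + v.size + 1)
  | loop_stop {c p : Prog} {v : Data} {s : ℕ} (hc : Runs c v .nil s) :
      Runs (.loop c p) v v (s + v.size + 1)
  | loop_step {c p : Prog} {v a b w u : Data} {s t r : ℕ} (hc : Runs c v (.cons a b) s)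
      (hp : Runs p v w t) (hl : Runs (.loop c p) w u r) :
      Runs (.loop c p) v u (s + t + r + v.size + 1)

/-- `f` is computable in polynomial time, for given encodings of its arguments and values: one
program computes it, within a number of steps polynomial in the size of the encoded argument. -/
def PolyTimeComputable {α β : Type} (encα : α → Data) (encβ : β → Data) (f : α → β) : Prop :=
  ∃ (p : Prog) (P : Polynomial ℕ),
    ∀ a : α, ∃ t ≤ P.eval (encα a).size, Runs p (encα a) (encβ (f a)) t

/-! ### Parameterized problems -/

/-- Encoding of an instance together with its parameter, the latter in binary. -/
def encodeParam {I : Type} (enc : I → Data) (x : I × ℕ) : Data :=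
  .cons (enc x.1) (Data.ofNat x.2)

/-- `κ` is a proper kernelization of the parameterized problem `L` (a set of pairs of an instance
and a parameter): it runs in polynomial time, maps an instance to an equivalent one, does not
increase the parameter, and yields instances (proper kernels) whose size is bounded by a function
of the parameter. -/
def IsProperKernelization {I : Type} (enc : I → Data) (L : Set (I × ℕ))
    (κ : I × ℕ → I × ℕ) : Prop :=
  PolyTimeComputable (encodeParam enc) (encodeParam enc) κ ∧
  (∀ x, x ∈ L ↔ κ x ∈ L) ∧
  (∀ x, (κ x).2 ≤ x.2) ∧
  ∃ g : ℕ → ℕ, ∀ x, (enc (κ x).1).size ≤ g x.2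

/-! ### CNF formulas -/

/-- A clause over the variables `0, …, n - 1`: a set of literals, where `(i, true)` is the
variable `i` and `(i, false)` its negation. -/
abbrev Clause (n : ℕ) : Type := Finset (Fin n × Bool)

/-- A CNF formula: a finite set of variables, named `0, …, numVars - 1` (they need not all occur
in clauses), and a finite multiset of non-empty clauses, listed in some order. A clause is
listed as many times as it appears. -/
structure CNF : Type where
  numVars : ℕ
  clauses : List (Clause numVars)
  nonempty_of_mem : ∀ c ∈ clauses, c.Nonempty

namespace CNF

/-- The number `m` of clauses, counted with multiplicity. -/
def numClauses (F : CNF) : ℕ := F.clauses.length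

/-- A truth assignment satisfies a clause if it makes one of its literals true. -/
def Satisfies {n : ℕ} (α : Fin n → Bool) (c : Clause n) : Prop :=
  ∃ l ∈ c, α l.1 = l.2

instance {n : ℕ} (α : Fin n → Bool) (c : Clause n) : Decidable (Satisfies α c) :=
  inferInstanceAs (Decidable (∃ l ∈ c, α l.1 = l.2))

/-- The number of clauses, counted with multiplicity, that a truth assignment satisfies. -/
def numSat (F : CNF) (α : Fin F.numVars → Bool) : ℕ :=
  F.clauses.countP (fun c => decide (Satisfies α c))

/-- `sat(F)`: the maximum number of clauses satisfied by a truth assignment. -/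
def sat (F : CNF) : ℕ := Finset.univ.sup F.numSat

/-- A clause as data: for each variable in turn, whether it occurs positively and whether it
occurs negatively. -/
def encodeClause {n : ℕ} (c : Clause n) : Data :=
  Data.ofList ((List.finRange n).map fun i =>
    .cons (Data.ofBool (decide ((i, true) ∈ c))) (Data.ofBool (decide ((i, false) ∈ c))))

/-- A formula as data: the list of its variables (one mark for each of them) and the list of its
clauses. -/
def encode (F : CNF) : Data :=
  .cons (Data.ofUnary F.numVars) (Data.ofList (F.clauses.map encodeClause))

end CNF

/-- The parameterized problem SAT-A(m/2): given a CNF formula `F` with `m` clauses and a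
nonnegative integer parameter `k`, decide whether `sat(F) ≥ m/2 + k`. -/
def SATAboveHalf : Set (CNF × ℕ) :=
  {x | (x.1.numClauses : ℝ) / 2 + (x.2 : ℝ) ≤ (x.1.sat : ℝ)}

end SATKernel

namespace SATKernel

open Polynomial

/-! ### A calculus of polynomial-time functions -/

/-! Two reductions bring a formula into a form in which many variables or many clauses force a
yes-instance. Of two complementary unit clauses every assignment satisfies exactly one, so deleting
the pair lowers both sat and m/2 by one (`cancelUnits_spec`).

The second reduction leaves only variables that can be matched to distinct clauses. An auction does
the work of bipartite matching: a variable owning nothing buys a cheapest clause containing it,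
raising its price by one. Hence an owned clause costs at most one more than any clause in which its
owner occurs. By pigeonhole some price g ≤ m is missing. Clauses above g are owned, and their owners
occur in no clause below g; every variable of a clause below g owns something. The clauses above g
can therefore all be satisfied by their owners without affecting the rest. Shrinking each of them to
one literal of its owner, instead of deleting it, keeps m and k unchanged and leaves only owners as
variables (`settled_auction`, `Settled.aboveHalf_iff`, `reduceOwned_spec`).

A reduced formula with n variables has sat ≥ m/2 + n/4, by two assignments that satisfy every clause
at least once between them and many clauses twice (`two_mul_card_add_le`), and sat ≥ (√5 − 1)m/2, by
a biased random assignment (`golden_mul_card_le`). If n > 4k or m > (2√5 + 4)k, one of these bounds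
gives a yes-instance; otherwise the reduced formula with the same k is the kernel. If k exceeds the
number of clauses, the answer is no.

For the running time, the algorithm is written on lists and unary numbers and assembled from closure
properties of `PT`, the central one being folds with controlled accumulators (`PT.foldl`). The list
form of a formula has the same encoding as the formula (`encodeParam_eq`), so the bound transfers.
-/

theorem eval_mono (P : ℕ[X]) : Monotone fun n : ℕ => P.eval n := by
  intro a b h
  simp only [eval_eq_sum_range]
  gcongr

theorem Data.size_head_le (d : Data) : d.head.size ≤ d.size := by
  cases d <;> simp [Data.size, Data.head]; omega

theorem Data.size_tail_le (d : Data) : d.tail.size ≤ d.size := by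
  cases d <;> simp [Data.size, Data.tail]; omega

/-- The charges dominate the size of the output, so a time bound is also an output bound;
composition needs this to feed one polynomial into another. -/
theorem Runs.size_le {p : Prog} {v w : Data} {t : ℕ} (h : Runs p v w t) : w.size ≤ t := by
  induction h with
  | head v => have := v.size_head_le; omega
  | tail v => have := v.size_tail_le; omega
  | nil v => simp [Data.size]
  | _ => (try simp only [Data.size] at *); omega

/-- A type whose elements are stored as data. -/
class Enc (α : Type) where
  enc : α → Data

open Enc

instance : Enc Unit := ⟨fun _ => .nil⟩
instance : Enc Bool := ⟨Data.ofBool⟩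
instance : Enc ℕ := ⟨Data.ofUnary⟩
instance {α β : Type} [Enc α] [Enc β] : Enc (α × β) := ⟨fun x => .cons (enc x.1) (enc x.2)⟩
instance {α : Type} [Enc α] : Enc (List α) := ⟨fun l => .ofList (l.map enc)⟩

/-- The size of the data that stores `a`. -/
def esize {α : Type} [Enc α] (a : α) : ℕ := (enc a).size

section
variable {α β γ σ : Type} [Enc α] [Enc β] [Enc γ] [Enc σ]

theorem enc_pair (a : α) (b : β) : enc (a, b) = .cons (enc a) (enc b) := rfl
theorem enc_nil : enc ([] : List α) = .nil := rfl
theorem enc_cons (a : α) (l : List α) : enc (a :: l) = .cons (enc a) (enc l) := rfl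
theorem enc_true : enc true = .cons .nil .nil := rfl
theorem enc_false : enc false = .nil := rfl
theorem enc_succ (n : ℕ) : enc (n + 1) = .cons .nil (enc n) := by
  simp [enc, Data.ofUnary, List.replicate_succ, Data.ofList]

/-- Unary numbers are lists of marks, so iterating a number of times becomes a list fold. -/
theorem enc_nat (n : ℕ) : enc n = enc (List.replicate n ()) := by
  simp [enc, Data.ofUnary]

@[simp] theorem esize_pair (a : α) (b : β) : esize (a, b) = esize a + esize b + 1 := rfl
@[simp] theorem esize_nil : esize ([] : List α) = 1 := rfl
@[simp] theorem esize_cons (a : α) (l : List α) : esize (a :: l) = esize a + esize l + 1 := rfl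
@[simp] theorem esize_unit (a : Unit) : esize a = 1 := rfl

theorem esize_bool (b : Bool) : esize b ≤ 3 := by
  cases b <;> simp [esize, enc, Data.ofBool, Data.size]

@[simp] theorem esize_nat (n : ℕ) : esize n = 2 * n + 1 := by
  induction n with
  | zero => rfl
  | succ n ih =>
    have : esize (n + 1) = esize n + 2 := by
      simp only [esize, enc_succ, Data.size]; omega
    omega

theorem length_lt_esize (l : List α) : l.length < esize l := by
  induction l with
  | nil => simp
  | cons a l ih => simp only [List.length_cons, esize_cons]; omega

theorem esize_le_of_mem {a : α} {l : List α} (h : a ∈ l) : esize a ≤ esize l := by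
  induction l with
  | nil => simp at h
  | cons b l ih =>
    rcases List.mem_cons.1 h with rfl | h
    · simp only [esize_cons]; omega
    · have := ih h; simp only [esize_cons]; omega

/-- Polynomial-time computability with respect to the standard encodings. -/
@[fun_prop]
def PT (f : α → β) : Prop := PolyTimeComputable enc enc f

theorem PT.size_le {f : α → β} (hf : PT f) : ∃ P : ℕ[X], ∀ a, esize (f a) ≤ P.eval (esize a) := by
  obtain ⟨p, P, h⟩ := hf
  refine ⟨P, fun a => ?_⟩
  obtain ⟨t, ht, hr⟩ := h a
  exact hr.size_le.trans ht

theorem PT.of_enc_eq {f : α → β} (h : ∀ a, enc (f a) = enc a) : PT f :=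
  ⟨.id, X + 1, fun a => ⟨(enc a).size + 1, by simp, by rw [h]; exact Runs.id _⟩⟩

@[fun_prop]
theorem PT.id : PT (fun a : α => a) := PT.of_enc_eq fun _ => rfl

theorem PT.of_enc_head {f : α → β} (h : ∀ a, enc (f a) = (enc a).head) : PT f :=
  ⟨.head, X + 1, fun a => ⟨(enc a).size + 1, by simp, by rw [h]; exact Runs.head _⟩⟩

theorem PT.of_enc_tail {f : α → β} (h : ∀ a, enc (f a) = (enc a).tail) : PT f :=
  ⟨.tail, X + 1, fun a => ⟨(enc a).size + 1, by simp, by rw [h]; exact Runs.tail _⟩⟩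

/-- The program that returns a fixed value. -/
def constProg : Data → Prog
  | .nil => .nil
  | .cons a b => .cons (constProg a) (constProg b)

@[fun_prop]
theorem PT.const (b : β) : PT (fun _ : α => b) := by
  have key : ∀ d : Data, ∃ P : ℕ[X], ∀ v : Data,
      ∃ t ≤ P.eval v.size, Runs (constProg d) v d t := by
    intro d
    induction d with
    | nil => exact ⟨X + 1, fun v => ⟨_, by simp, Runs.nil v⟩⟩
    | cons a b iha ihb =>
      obtain ⟨P, hP⟩ := iha
      obtain ⟨Q, hQ⟩ := ihb
      refine ⟨P + Q + X + 1, fun v => ?_⟩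
      obtain ⟨s, hs, hrs⟩ := hP v
      obtain ⟨t, ht, hrt⟩ := hQ v
      exact ⟨_, by simp; omega, Runs.cons hrs hrt⟩
  obtain ⟨P, hP⟩ := key (enc b)
  exact ⟨_, P, fun a => hP _⟩

@[fun_prop]
theorem PT.comp {f : β → γ} {g : α → β} (hf : PT f) (hg : PT g) : PT (fun a => f (g a)) := by
  obtain ⟨p, P, hp⟩ := hf
  obtain ⟨q, Q, hq⟩ := hg
  refine ⟨.seq q p, Q + P.comp Q + X + 1, fun a => ?_⟩
  obtain ⟨s, hs, hrs⟩ := hq a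
  obtain ⟨t, ht, hrt⟩ := hp (g a)
  refine ⟨_, ?_, Runs.seq hrs hrt⟩
  have := eval_mono P (hrs.size_le.trans hs)
  simp only [eval_add, eval_comp, eval_X, eval_one] at *
  omega

@[fun_prop]
theorem PT.prodMk {f : α → β} {g : α → γ} (hf : PT f) (hg : PT g) : PT (fun a => (f a, g a)) := by
  obtain ⟨p, P, hp⟩ := hf
  obtain ⟨q, Q, hq⟩ := hg
  refine ⟨.cons p q, P + Q + X + 1, fun a => ?_⟩
  obtain ⟨s, hs, hrs⟩ := hp a
  obtain ⟨t, ht, hrt⟩ := hq a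
  exact ⟨_, by simp; omega, Runs.cons hrs hrt⟩

@[fun_prop]
theorem PT.fst : PT (fun x : α × β => x.1) := PT.of_enc_head fun _ => rfl

@[fun_prop]
theorem PT.snd : PT (fun x : α × β => x.2) := PT.of_enc_tail fun _ => rfl

@[fun_prop]
theorem PT.list_cons {f : α → β} {g : α → List β} (hf : PT f) (hg : PT g) :
    PT (fun a => f a :: g a) :=
  PT.comp (f := fun x : β × List β => x.1 :: x.2) (PT.of_enc_eq fun _ => rfl) (hf.prodMk hg)

@[fun_prop]
theorem PT.list_tail {f : α → List β} (hf : PT f) : PT (fun a => (f a).tail) :=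
  PT.comp (f := fun x : List β => x.tail) (PT.of_enc_tail fun l => by cases l <;> rfl) hf

@[fun_prop]
theorem PT.succ {f : α → ℕ} (hf : PT f) : PT (fun a => f a + 1) := by
  have : PT (fun x : Unit × ℕ => x.2 + 1) := PT.of_enc_eq fun x => by rw [enc_succ]; rfl
  exact this.comp ((PT.const ()).prodMk hf)

@[fun_prop]
theorem PT.pred {f : α → ℕ} (hf : PT f) : PT (fun a => f a - 1) := by
  have : PT (fun x : ℕ => x - 1) := PT.of_enc_tail fun x => by
    cases x with
    | zero => rfl
    | succ n => rw [enc_succ]; rfl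
  exact this.comp hf

@[fun_prop]
theorem PT.ite {c : α → Bool} {f g : α → β} (hc : PT c) (hf : PT f) (hg : PT g) :
    PT (fun a => if c a then f a else g a) := by
  obtain ⟨r, R, hr⟩ := hc
  obtain ⟨p, P, hp⟩ := hf
  obtain ⟨q, Q, hq⟩ := hg
  refine ⟨.ite r p q, R + P + Q + X + 1, fun a => ?_⟩
  obtain ⟨u, hu, hru⟩ := hr a
  obtain ⟨s, hs, hrs⟩ := hp a
  obtain ⟨t, ht, hrt⟩ := hq a
  by_cases h : c a = true
  · rw [h, enc_true] at hru
    simp only [h, if_true]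
    exact ⟨_, by simp; omega, Runs.ite_true hru hrs⟩
  · have h' : c a = false := by simpa using h
    rw [h', enc_false] at hru
    simp only [h', Bool.false_eq_true, if_false]
    exact ⟨_, by simp; omega, Runs.ite_false hru hrt⟩

@[fun_prop]
theorem PT.not {f : α → Bool} (hf : PT f) : PT (fun a => !f a) := by
  have : PT (fun a => if f a then false else true) := by fun_prop
  convert this using 2 with a
  cases f a <;> rfl

@[fun_prop]
theorem PT.and {f g : α → Bool} (hf : PT f) (hg : PT g) : PT (fun a => f a && g a) := by
  have : PT (fun a => if f a then g a else false) := by fun_prop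
  convert this using 2 with a
  cases f a <;> rfl

@[fun_prop]
theorem PT.or {f g : α → Bool} (hf : PT f) (hg : PT g) : PT (fun a => f a || g a) := by
  have : PT (fun a => if f a then true else g a) := by fun_prop
  convert this using 2 with a
  cases f a <;> rfl

/-- A list is tested for emptiness. -/
@[fun_prop]
theorem PT.isEmpty {f : α → List β} (hf : PT f) : PT (fun a => (f a).isEmpty) := by
  have : PT (fun l : List β => l.isEmpty) := by
    refine ⟨.ite .id .nil (.cons .nil .nil), X * 5 + 10, fun l => ?_⟩
    cases l with
    | nil => exact ⟨_, by simp [enc_nil, Data.size], Runs.ite_false (Runs.id _) (Runs.cons (Runs.nil _) (Runs.nil _))⟩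
    | cons a l => exact ⟨_, by rw [enc_cons]; simp; omega, Runs.ite_true (Runs.id _) (Runs.nil _)⟩
  exact this.comp hf

/-- One step of the loop that folds a list; the state is the context, the accumulator and the rest
of the list. -/
def foldBody (p : Prog) : Prog :=
  .cons .head (.cons (.seq (.cons .head (.cons (.seq .tail .head) (.seq .tail (.seq .tail .head)))) p)
    (.seq .tail (.seq .tail .tail)))

theorem runs_foldBody {p : Prog} {c s a l w : Data} {t : ℕ}
    (h : Runs p (.cons c (.cons s a)) w t) :
    ∃ u ≤ t + 30 * (Data.cons c (.cons s (.cons a l))).size, Runs (foldBody p)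
      (.cons c (.cons s (.cons a l))) (.cons c (.cons w l)) u := by
  refine ⟨_, ?_, Runs.cons (Runs.head _) (Runs.cons (Runs.seq (Runs.cons (Runs.head _)
    (Runs.cons (Runs.seq (Runs.tail _) (Runs.head _)) (Runs.seq (Runs.tail _)
      (Runs.seq (Runs.tail _) (Runs.head _))))) h) (Runs.seq (Runs.tail _)
      (Runs.seq (Runs.tail _) (Runs.tail _))))⟩
  simp only [Data.size, Data.tail]
  omega

/-- The size bound ranges over prefixes because the accumulators met by the loop are exactly the
folds over prefixes. -/
theorem runs_fold_loop {f : γ → σ → α → σ} {p : Prog} {P : ℕ[X]}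
    (hp : ∀ x : γ × σ × α, ∃ t ≤ P.eval (esize x), Runs p (enc x) (enc (f x.1 x.2.1 x.2.2)) t)
    (c : γ) (M : ℕ) (l : List α) (s : σ) (hM : esize c + esize l ≤ M)
    (hs : ∀ l₁, l₁ <+: l → esize (l₁.foldl (f c) s) ≤ M) :
    ∃ t ≤ (l.length + 1) * (P.eval (2 * M + 2) + 40 * (2 * M + 2)),
      Runs (.loop (.seq .tail .tail) (foldBody p)) (enc (c, s, l)) (enc (c, l.foldl (f c) s, ([] : List α))) t := by
  induction l generalizing s with
  | nil =>
    have h0 := hs [] (List.nil_prefix)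
    refine ⟨_, ?_, Runs.loop_stop (Runs.seq (Runs.tail _) (Runs.tail _))⟩
    -- `2 * M + 2` bounds the state: `M` for context and list together, `M` for the accumulator, two
    -- pairing nodes.
    have h1 : (enc (c, s, ([] : List α))).size ≤ 2 * M + 2 := by
      change esize (c, s, ([] : List α)) ≤ _
      simp only [esize_pair, List.foldl_nil] at *
      omega
    have h2 := (enc (c, s, ([] : List α))).size_tail_le
    simp only [List.length_nil]
    omega
  | cons a l ih =>
    have h0 := hs [] (List.nil_prefix)
    have hst : esize (c, s, a :: l) ≤ 2 * M + 2 := by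
      simp only [esize_pair, List.foldl_nil] at *
      omega
    have hsx : esize (c, s, a) ≤ 2 * M + 2 := by
      simp only [esize_pair, esize_cons] at *
      omega
    obtain ⟨t, ht, hrt⟩ := hp (c, s, a)
    have ht' := ht.trans (eval_mono P hsx)
    obtain ⟨u, hu, hru⟩ := runs_foldBody (l := enc l) hrt
    obtain ⟨r, hr, hrr⟩ := ih (f c s a) (by simp only [esize_cons] at hM; omega) (fun l₁ h => by
      have := hs (a :: l₁) (by simpa using h)
      simpa using this)
    refine ⟨_, ?_, Runs.loop_step (a := enc a) (b := enc l) (Runs.seq (Runs.tail _) (Runs.tail _)) hru hrr⟩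
    have h1 : (enc (c, s, a :: l)).size ≤ 2 * M + 2 := hst
    have h2 := (enc (c, s, a :: l)).size_tail_le
    have h3 : u ≤ t + 30 * (enc (c, s, a :: l)).size := hu
    simp only [List.length_cons]
    simp only at ht'
    generalize P.eval (2 * M + 2) = E at *
    have : (l.length + 1 + 1) * (E + 40 * (2 * M + 2)) = (l.length + 1) * (E + 40 * (2 * M + 2)) + (E + 40 * (2 * M + 2)) := by ring
    rw [this]
    change _ + _ + _ + (enc (c, s, a :: l)).size + 1 ≤ _
    omega

/-- Folding a list, when the size of the accumulator stays polynomial. -/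
theorem PT.foldl_of_bound {f : γ → σ → α → σ} {s : γ → σ} {l : γ → List α}
    (hf : PT (fun x : γ × σ × α => f x.1 x.2.1 x.2.2)) (hs : PT s) (hl : PT l)
    (hB : ∃ B : ℕ[X], ∀ c l₁, l₁ <+: l c → esize (l₁.foldl (f c) (s c)) ≤ B.eval (esize c)) :
    PT (fun c => (l c).foldl (f c) (s c)) := by
  obtain ⟨L, hL⟩ := hl.size_le
  obtain ⟨p, P, hp⟩ := hf
  obtain ⟨q, Q, hq⟩ := (PT.id (α := γ)).prodMk (hs.prodMk hl)
  obtain ⟨B, hB⟩ := hB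
  let M : ℕ[X] := X + L + B
  let T : ℕ[X] := L * (P.comp (2 * M + 2) + 40 * (2 * M + 2))
  refine ⟨.seq q (.seq (.loop (.seq .tail .tail) (foldBody p)) (.seq .tail .head)),
    X + 4 * Q + 8 * T + 10, fun c => ?_⟩
  obtain ⟨t, ht, hrt⟩ := hq c
  obtain ⟨u, hu, hru⟩ := runs_fold_loop (P := P) hp c (M.eval (esize c)) (l c) (s c)
    (by simp only [M, eval_add, eval_X]; have := hL c; omega)
    (fun l₁ h => by simp only [M, eval_add, eval_X]; have := hB c l₁ h; omega)
  have hu' : u ≤ T.eval (esize c) := by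
    refine hu.trans ?_
    simp only [T, eval_mul, eval_add, eval_comp, eval_ofNat]
    gcongr
    exact (length_lt_esize _).trans_le (hL c)
  refine ⟨_, ?_, Runs.seq hrt (Runs.seq hru (Runs.seq (Runs.tail _) (Runs.head _)))⟩
  have h1 : (enc (c, s c, l c)).size ≤ t := hrt.size_le
  have h2 := hru.size_le
  have h3 := (enc (c, (l c).foldl (f c) (s c), ([] : List α))).size_tail_le
  have e1 : (enc c).size = esize c := rfl
  have ht' : t ≤ Q.eval (esize c) := ht
  rw [e1]
  simp only [eval_add, eval_mul, eval_X, eval_ofNat]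
  omega

/-- Folding a list, when a step adds an amount polynomial in the sizes of the context and of the
list item to the size of the accumulator. -/
theorem PT.foldl {f : γ → σ → α → σ} {s : γ → σ} {l : γ → List α}
    (hf : PT (fun x : γ × σ × α => f x.1 x.2.1 x.2.2)) (hs : PT s) (hl : PT l)
    (hG : ∃ G : ℕ[X], ∀ c s a, esize (f c s a) ≤ esize s + G.eval (esize c + esize a)) :
    PT (fun c => (l c).foldl (f c) (s c)) := by
  obtain ⟨L, hL⟩ := hl.size_le
  obtain ⟨S, hS⟩ := hs.size_le
  obtain ⟨G, hG⟩ := hG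
  refine PT.foldl_of_bound hf hs hl ⟨S + L * G.comp (X + L), fun c l₁ h => ?_⟩
  have key : ∀ (l₁ : List α) (t : σ), (∀ a ∈ l₁, esize a ≤ L.eval (esize c)) →
      esize (l₁.foldl (f c) t) ≤ esize t + l₁.length * G.eval (esize c + L.eval (esize c)) := by
    intro l₁
    induction l₁ with
    | nil => simp
    | cons a l₁ ih =>
      intro t ht
      have h1 := ih (f c t a) (fun b hb => ht b (List.mem_cons_of_mem _ hb))
      have h2 := hG c t a
      have h3 := eval_mono G (Nat.add_le_add_left (ht a List.mem_cons_self) (esize c))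
      simp only [List.foldl_cons, List.length_cons] at *
      rw [Nat.succ_mul]
      omega
  refine (key l₁ (s c) fun a ha => (esize_le_of_mem (h.subset ha)).trans (hL c)).trans ?_
  simp only [eval_add, eval_mul, eval_comp, eval_X]
  gcongr
  · exact hS c
  · exact h.length_le.trans ((length_lt_esize _).le.trans (hL c))

end

/-! ### List operations and unary arithmetic in polynomial time. -/

section
variable {α β γ σ : Type} [Enc α] [Enc β] [Enc γ] [Enc σ]

/-- Folding a list with an accumulator that collects items whose size is polynomial. -/
theorem PT.foldl_bounded {f : γ → σ → α → σ} {s : γ → σ} {l : γ → List α}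
    (hf : PT (fun x : γ × σ × α => f x.1 x.2.1 x.2.2)) (hs : PT s) (hl : PT l)
    (hG : ∃ G : ℕ[X], ∀ c s a, esize (f c s a) ≤ G.eval (esize c + esize a)) :
    PT (fun c => (l c).foldl (f c) (s c)) := by
  obtain ⟨G, hG⟩ := hG
  exact PT.foldl hf hs hl ⟨G, fun c s a => (hG c s a).trans (Nat.le_add_left _ _)⟩

theorem PT.any {p : γ → α → Bool} {l : γ → List α} (hp : PT (fun x : γ × α => p x.1 x.2))
    (hl : PT l) : PT (fun c => (l c).any (p c)) := by
  have h := PT.foldl_bounded (f := fun c s a => s || p c a) (s := fun _ => false) (l := l)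
    (PT.or (by fun_prop) (hp.comp (g := fun x : γ × Bool × α => (x.1, x.2.2)) (by fun_prop)))
    (by fun_prop) hl ⟨3, fun c s a => by simpa using esize_bool _⟩
  convert h using 2 with c
  have key : ∀ (l : List α) (b : Bool), l.foldl (fun s a => s || p c a) b = (b || l.any (p c)) := by
    intro l
    induction l with
    | nil => simp
    | cons a l ih => intro b; simp [ih, Bool.or_assoc]
  simp [key]

theorem PT.all {p : γ → α → Bool} {l : γ → List α} (hp : PT (fun x : γ × α => p x.1 x.2))
    (hl : PT l) : PT (fun c => (l c).all (p c)) := by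
  have h := PT.not (PT.any (p := fun c a => !p c a) hp.not hl)
  convert h using 2 with c
  simp [List.all_eq_not_any_not]

@[fun_prop]
theorem PT.reverse {l : γ → List α} (hl : PT l) : PT (fun c => (l c).reverse) := by
  have h := PT.foldl (f := fun (_ : γ) s a => a :: s) (s := fun _ => []) (l := l)
    (by fun_prop) (by fun_prop) hl ⟨X + 1, fun c s a => by simp; omega⟩
  convert h using 2 with c
  simp

theorem PT.map {g : γ → α → β} {l : γ → List α} (hg : PT (fun x : γ × α => g x.1 x.2))
    (hl : PT l) : PT (fun c => (l c).map (g c)) := by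
  obtain ⟨G, hG⟩ := hg.size_le
  have h := PT.foldl (f := fun c s a => g c a :: s) (s := fun _ => []) (l := l)
    (PT.list_cons (hg.comp (g := fun x : γ × List β × α => (x.1, x.2.2)) (by fun_prop))
      (by fun_prop)) (by fun_prop) hl
    ⟨G.comp (X + 1) + 1, fun c s a => by have := hG (c, a); simp at *; omega⟩
  convert h.reverse using 2 with c
  have key : ∀ (l : List α) (o : List β), l.foldl (fun s a => g c a :: s) o = (l.map (g c)).reverse ++ o := by
    intro l
    induction l with
    | nil => simp
    | cons a l ih => intro o; simp [ih]
  simp [key]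

theorem PT.filter {p : γ → α → Bool} {l : γ → List α} (hp : PT (fun x : γ × α => p x.1 x.2))
    (hl : PT l) : PT (fun c => (l c).filter (p c)) := by
  have h := PT.foldl (f := fun c s a => if p c a then a :: s else s) (s := fun _ => []) (l := l)
    (PT.ite (hp.comp (g := fun x : γ × List α × α => (x.1, x.2.2)) (by fun_prop)) (by fun_prop)
      (by fun_prop)) (by fun_prop) hl ⟨X + 1, fun c s a => by split <;> simp; omega⟩
  convert h.reverse using 2 with c
  have key : ∀ (l : List α) (o : List α), l.foldl (fun s a => if p c a then a :: s else s) o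
      = (l.filter (p c)).reverse ++ o := by
    intro l
    induction l with
    | nil => simp
    | cons a l ih => intro o; by_cases h : p c a <;> simp [ih, h]
  simp [key]

@[fun_prop]
theorem PT.length {l : γ → List α} (hl : PT l) : PT (fun c => (l c).length) := by
  have h := PT.foldl (f := fun (_ : γ) (s : ℕ) (_ : α) => s + 1) (s := fun _ => 0) (l := l)
    (by fun_prop) (by fun_prop) hl ⟨2, fun c s a => by simp; omega⟩
  convert h using 2 with c
  simp

@[fun_prop]
theorem PT.headD {l : γ → List α} {d : γ → α} (hl : PT l) (hd : PT d) :
    PT (fun c => (l c).headD (d c)) := by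
  -- Keeping the last item of the reversed list yields the head.
  have h := PT.foldl_bounded (f := fun (_ : γ) (_ : α) (a : α) => a) (s := d)
    (l := fun c => (l c).reverse)
    (by fun_prop) hd (by fun_prop) ⟨X, fun c s a => by simp⟩
  convert h using 2 with c
  cases l c <;> simp

theorem PT.iterate {f : γ → σ → σ} {s : γ → σ} {n : γ → ℕ}
    (hf : PT (fun x : γ × σ => f x.1 x.2)) (hs : PT s) (hn : PT n)
    (hG : ∃ G : ℕ[X], ∀ c s, esize (f c s) ≤ esize s + G.eval (esize c)) :
    PT (fun c => (f c)^[n c] (s c)) := by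
  have hr : PT (fun n : ℕ => List.replicate n ()) := PT.of_enc_eq fun n => (enc_nat n).symm
  obtain ⟨G, hG⟩ := hG
  have h := PT.foldl (f := fun c s (_ : Unit) => f c s) (s := s) (l := fun c => List.replicate (n c) ())
    (hf.comp (g := fun x : γ × σ × Unit => (x.1, x.2.1)) (by fun_prop)) hs (hr.comp hn)
    ⟨G, fun c s a => (hG c s).trans (by gcongr; exact eval_mono G (Nat.le_add_right _ _))⟩
  convert h using 2 with c
  generalize s c = x
  induction n c generalizing x with
  | zero => rfl
  | succ n ih => rw [Function.iterate_succ_apply, ih, List.replicate_succ, List.foldl_cons]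

@[fun_prop]
theorem PT.getD {l : γ → List α} {n : γ → ℕ} {d : γ → α} (hl : PT l) (hn : PT n) (hd : PT d) :
    PT (fun c => (l c).getD (n c) (d c)) := by
  have h := PT.iterate (f := fun (_ : γ) (s : List α) => s.tail) (s := l) (n := n) (by fun_prop) hl hn
    ⟨0, fun c s => by cases s <;> simp; omega⟩
  convert h.headD hd using 2 with c
  generalize l c = x
  induction n c generalizing x with
  | zero => cases x <;> simp
  | succ n ih => rw [Function.iterate_succ_apply, ← ih]; cases x <;> simp

@[fun_prop]
theorem PT.add {m n : γ → ℕ} (hm : PT m) (hn : PT n) : PT (fun c => m c + n c) := by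
  have h := PT.iterate (f := fun (_ : γ) (s : ℕ) => s + 1) (s := m) (n := n) (by fun_prop) hm hn
    ⟨2, fun c s => by simp; omega⟩
  convert h using 2 with c
  simp

@[fun_prop]
theorem PT.sub {m n : γ → ℕ} (hm : PT m) (hn : PT n) : PT (fun c => m c - n c) := by
  have h := PT.iterate (f := fun (_ : γ) (s : ℕ) => s - 1) (s := m) (n := n) (by fun_prop) hm hn
    ⟨0, fun c s => by simp⟩
  convert h using 2 with c
  induction n c with
  | zero => rfl
  | succ k ih => rw [Function.iterate_succ_apply', ← ih]; omega

@[fun_prop]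
theorem PT.mul {m n : γ → ℕ} (hm : PT m) (hn : PT n) : PT (fun c => m c * n c) := by
  obtain ⟨M, hM⟩ := hm.size_le
  have h := PT.iterate (f := fun c (s : ℕ) => s + m c) (s := fun _ => 0) (n := n)
    (by fun_prop) (by fun_prop) hn
    ⟨M, fun c s => by have := hM c; simp at *; omega⟩
  convert h using 2 with c
  induction n c with
  | zero => rfl
  | succ k ih => rw [Function.iterate_succ_apply', ← ih, Nat.mul_succ]

theorem PT.isZero : PT (fun n : ℕ => decide (n = 0)) := by
  have hr : PT (fun n : ℕ => List.replicate n ()) := PT.of_enc_eq fun n => (enc_nat n).symm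
  convert hr.isEmpty using 2 with n
  cases n <;> simp [List.replicate_succ]

@[fun_prop]
theorem PT.decide_le {m n : γ → ℕ} (hm : PT m) (hn : PT n) : PT (fun c => decide (m c ≤ n c)) := by
  convert PT.isZero.comp (hm.sub hn) using 2 with c
  simp [Nat.sub_eq_zero_iff_le]

@[fun_prop]
theorem PT.decide_lt {m n : γ → ℕ} (hm : PT m) (hn : PT n) : PT (fun c => decide (m c < n c)) :=
  PT.decide_le (m := fun c => m c + 1) (by fun_prop) hn

@[fun_prop]
theorem PT.decide_eq {m n : γ → ℕ} (hm : PT m) (hn : PT n) : PT (fun c => decide (m c = n c)) := by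
  have : PT (fun c => decide (m c ≤ n c) && decide (n c ≤ m c)) := by fun_prop
  convert this using 2 with c
  rw [← Bool.decide_and, decide_eq_decide]
  omega

@[fun_prop]
theorem PT.toNat {b : γ → Bool} (hb : PT b) : PT (fun c => (b c).toNat) := by
  have : PT (fun c => if b c then 1 else 0) := by fun_prop
  convert this using 2 with c
  cases b c <;> rfl

@[fun_prop]
theorem PT.min {m n : γ → ℕ} (hm : PT m) (hn : PT n) : PT (fun c => min (m c) (n c)) := by
  have : PT (fun c => if decide (m c ≤ n c) then m c else n c) := by fun_prop
  convert this using 2 with c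
  simp [min_def]

@[fun_prop]
theorem PT.range {n : γ → ℕ} (hn : PT n) : PT (fun c => List.range (n c)) := by
  have hr : PT (fun n : ℕ => List.replicate n ()) := PT.of_enc_eq fun n => (enc_nat n).symm
  -- The minimum never takes effect in the actual fold; it bounds the new item for arbitrary
  -- accumulators, as `PT.foldl` demands.
  have h := PT.foldl (f := fun (c : γ) (s : List ℕ) (_ : Unit) => Min.min s.length (n c) :: s)
    (s := fun _ => []) (l := fun c => List.replicate (n c) ())
    (by fun_prop) (by fun_prop) (hr.comp hn) (by
      obtain ⟨N, hN⟩ := hn.size_le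
      refine ⟨N + 1, fun c s a => ?_⟩
      have h1 := hN c
      have h2 := eval_mono N (Nat.le_add_right (esize c) (esize a))
      simp at *
      omega)
  convert h.reverse using 2 with c
  have key : ∀ k ≤ n c, (List.replicate k ()).foldl (fun (s : List ℕ) _ => Min.min s.length (n c) :: s) []
      = (List.range k).reverse := by
    intro k hk
    induction k with
    | zero => rfl
    | succ k ih =>
      rw [List.replicate_succ', List.foldl_append, ih (by omega), List.range_succ]
      simp
      omega
  rw [key _ le_rfl, List.reverse_reverse]

/-- Update the first item that satisfies a test. -/
def updFirst {α : Type} (p : α → Bool) (u : α → α) : List α → List α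
  | [] => []
  | a :: l => if p a then u a :: l else a :: updFirst p u l

theorem PT.updFirst {p : γ → α → Bool} {u : γ → α → α} {l : γ → List α}
    (hp : PT (fun x : γ × α => p x.1 x.2)) (hu : PT (fun x : γ × α => u x.1 x.2))
    (hl : PT l) : PT (fun c => updFirst (p c) (u c) (l c)) := by
  obtain ⟨G, hG⟩ := hu.size_le
  have hp' : PT (fun x : γ × (Bool × List α) × α => p x.1 x.2.2) :=
    hp.comp (g := fun x : γ × (Bool × List α) × α => (x.1, x.2.2)) (by fun_prop)
  have hu' : PT (fun x : γ × (Bool × List α) × α => u x.1 x.2.2) :=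
    hu.comp (g := fun x : γ × (Bool × List α) × α => (x.1, x.2.2)) (by fun_prop)
  -- The Boolean flag records whether the update has already happened.
  have h := PT.foldl (f := fun c (s : Bool × List α) a =>
      if !s.1 && p c a then (true, u c a :: s.2) else (s.1, a :: s.2)) (s := fun _ => (false, []))
    (l := l) (by fun_prop) (by fun_prop) hl
    ⟨G.comp (X + 1) + X + 5, fun c s a => by
      have h1 := hG (c, a)
      have h2 := esize_bool true
      obtain ⟨b, s⟩ := s
      split <;> simp at * <;> omega⟩
  convert (PT.snd.comp h).reverse using 2 with c
  have key1 : ∀ l o : List α, (l.foldl (fun (s : Bool × List α) a =>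
      if !s.1 && p c a then (true, u c a :: s.2) else (s.1, a :: s.2)) (true, o))
      = (true, l.reverse ++ o) := by
    intro l
    induction l with
    | nil => simp
    | cons a l ih => intro o; simpa using ih (a :: o)
  have key : ∀ l o : List α, (l.foldl (fun (s : Bool × List α) a =>
      if !s.1 && p c a then (true, u c a :: s.2) else (s.1, a :: s.2)) (false, o)).2
      = (SATKernel.updFirst (p c) (u c) l).reverse ++ o := by
    intro l
    induction l with
    | nil => simp [SATKernel.updFirst]
    | cons a l ih =>
      intro o
      by_cases h : p c a
      · rw [List.foldl_cons, if_pos (by simpa using h), key1]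
        simp [SATKernel.updFirst, h]
      · simpa [SATKernel.updFirst, h] using ih (a :: o)
  rw [key, List.append_nil, List.reverse_reverse]

end

/-! ### The algorithm -/

/-- A clause as a list: for each variable, whether it occurs positively and negatively. -/
abbrev RawClause : Type := List (Bool × Bool)

/-- The occurrences of the variable `i` in a clause. -/
def lits (c : RawClause) (i : ℕ) : Bool × Bool := c.getD i (false, false)

/-- The variable `i` occurs in the clause. -/
def occurs (c : RawClause) (i : ℕ) : Bool := (lits c i).1 || (lits c i).2

/-- The number of literals of a clause. -/
def numLits (c : RawClause) : ℕ := c.foldl (fun s p => s + (p.1.toNat + p.2.toNat)) 0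

/-- The two clauses are unit clauses of complementary literals. -/
def conflict (c d : RawClause) : Bool :=
  decide (numLits c = 1) && decide (numLits d = 1) && (List.range c.length).any fun i =>
    (lits c i).1 && (lits d i).2 || (lits c i).2 && (lits d i).1

/-- Add a clause to a list without conflicting unit clauses, cancelling it if it is in conflict. -/
def cancelStep (l : List RawClause) (c : RawClause) : List RawClause :=
  if l.any (conflict c) then l.eraseP (conflict c) else c :: l

/-- Cancel the pairs of conflicting unit clauses. -/
def cancelUnits (l : List RawClause) : List RawClause := l.foldl cancelStep []

/-- A clause in an auction: its price, its owner (if the price is positive), and the clause. -/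
abbrev Entry : Type := ℕ × ℕ × RawClause

/-- The variable `i` owns the clause. -/
def owns (i : ℕ) (e : Entry) : Bool := decide (0 < e.1) && decide (e.2.1 = i)

/-- The clause has the lowest price among those that contain the variable `i`, and this price is
less than `N`. -/
def cheapest (N : ℕ) (S : List Entry) (i : ℕ) (e : Entry) : Bool :=
  (occurs e.2.2 i && decide (e.1 < N)) && S.all fun e' => !occurs e'.2.2 i || decide (e.1 ≤ e'.1)

/-- The variable `i` buys a cheapest clause, unless it owns one already. -/
def bid (N : ℕ) (S : List Entry) (i : ℕ) : List Entry :=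
  if S.any (owns i) then S else
    updFirst (cheapest N S i) (fun e => (e.1 + 1, i, e.2.2)) S

/-- All variables bid in turn. -/
def bidRound (n N : ℕ) (S : List Entry) : List Entry := (List.range n).foldl (bid N) S

/-- The final state of the auction of clauses among `n` variables. -/
def auction (n : ℕ) (l : List RawClause) : List Entry :=
  (bidRound n (l.length + 1))^[l.length * (l.length + 1) + 1] (l.map fun c => (0, 0, c))

/-- A price that does not occur. -/
def priceGap (S : List Entry) : ℕ :=
  ((List.range (S.length + 1)).filter fun g => S.all fun e => !decide (e.1 = g)).headD 0

/-- The variables that own a clause. -/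
def owners (n : ℕ) (S : List Entry) : List ℕ := (List.range n).filter fun i => S.any (owns i)

/-- The occurrences of the variable `j` that are kept: in a clause of price above `g`, only one
literal of the owner is. -/
def keptLits (g : ℕ) (e : Entry) (j : ℕ) : Bool × Bool :=
  if decide (e.1 ≤ g) then lits e.2.2 j else
    if decide (j = e.2.1) then ((lits e.2.2 j).1, !(lits e.2.2 j).1 && (lits e.2.2 j).2)
    else (false, false)

/-- Reduce a formula to one in which the variables own distinct clauses. -/
def reduceOwned (n : ℕ) (l : List RawClause) : ℕ × List RawClause :=
  ((owners n (auction n l)).length, (auction n l).map fun e =>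
    (owners n (auction n l)).map (keptLits (priceGap (auction n l)) e))

/-- The number with the given binary digits, or `N` if it is larger. -/
def cappedVal (N : ℕ) (l : List Bool) : ℕ := l.reverse.foldl (fun v b => min N (2 * v + b.toNat)) 0

/-- The size test for the parameter `k`. -/
def fits (k : ℕ) (F : ℕ × List RawClause) : Bool :=
  decide (F.1 ≤ 4 * k) &&
    decide ((F.2.length - 4 * k) * (F.2.length - 4 * k) ≤ 20 * (k * k))

/-- The kernelization on encoded instances. -/
def kernel (x : (ℕ × List RawClause) × List Bool) : (ℕ × List RawClause) × List Bool :=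
  if decide (cappedVal (x.1.2.length + 1) x.2 ≤ x.1.2.length) then
    if fits (cappedVal (x.1.2.length + 1) x.2) (reduceOwned x.1.1 (cancelUnits x.1.2)) then
      (reduceOwned x.1.1 (cancelUnits x.1.2), x.2)
    else ((0, []), [])
  else ((0, []), [true])

/-! ### The algorithm runs in polynomial time -/

/-- Tagging all items, untagging the first match and filtering reduces erasure to operations already
treated. -/
theorem eraseP_eq_updFirst {α : Type} (p : α → Bool) (l : List α) :
    l.eraseP p = (((updFirst (fun x : Bool × α => p x.2) (fun x => (false, x.2))
      (l.map fun a => (true, a))).filter fun x => x.1).map fun x => x.2) := by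
  induction l with
  | nil => simp [updFirst]
  | cons a l ih =>
    by_cases h : p a
    · simp [updFirst, h, List.filter_map, Function.comp_def]
    · simp [updFirst, h, ih]

section
variable {α γ : Type} [Enc α] [Enc γ]

@[fun_prop]
theorem PT.lits {c : γ → RawClause} {i : γ → ℕ} (hc : PT c) (hi : PT i) :
    PT (fun x => lits (c x) (i x)) := by
  unfold SATKernel.lits
  fun_prop

@[fun_prop]
theorem PT.occurs {c : γ → RawClause} {i : γ → ℕ} (hc : PT c) (hi : PT i) :
    PT (fun x => occurs (c x) (i x)) := by
  unfold SATKernel.occurs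
  fun_prop

@[fun_prop]
theorem PT.numLits {c : γ → RawClause} (hc : PT c) : PT (fun x => numLits (c x)) := by
  refine PT.foldl (f := fun (_ : γ) (s : ℕ) (p : Bool × Bool) => s + (p.1.toNat + p.2.toNat))
    (s := fun _ => 0) (by fun_prop) (by fun_prop) hc ⟨4, fun c s a => ?_⟩
  have h1 := Bool.toNat_le a.1
  have h2 := Bool.toNat_le a.2
  simp
  omega

@[fun_prop]
theorem PT.conflict {c d : γ → RawClause} (hc : PT c) (hd : PT d) :
    PT (fun x => conflict (c x) (d x)) := by
  unfold SATKernel.conflict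
  exact PT.and (by fun_prop) (PT.any (by fun_prop) (by fun_prop))

theorem PT.eraseP {p : γ → α → Bool} {l : γ → List α} (hp : PT (fun x : γ × α => p x.1 x.2))
    (hl : PT l) : PT (fun c => (l c).eraseP (p c)) := by
  simp only [eraseP_eq_updFirst]
  refine PT.map (by fun_prop) (PT.filter (by fun_prop) (PT.updFirst ?_ (by fun_prop)
    (PT.map (by fun_prop) hl)))
  exact hp.comp (g := fun x : γ × Bool × α => (x.1, x.2.2)) (by fun_prop)

theorem esize_eraseP_le (p : α → Bool) (l : List α) : esize (l.eraseP p) ≤ esize l := by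
  induction l with
  | nil => simp
  | cons a l ih =>
    by_cases h : p a
    · simp [h]; omega
    · simp [h]; omega

@[fun_prop]
theorem PT.cancelUnits {l : γ → List RawClause} (hl : PT l) : PT (fun x => cancelUnits (l x)) := by
  refine PT.foldl (f := fun (_ : γ) => cancelStep) (s := fun _ => []) ?_ (by fun_prop) hl
    ⟨X + 1, fun c s a => ?_⟩
  · unfold cancelStep
    exact PT.ite (PT.any (by fun_prop) (by fun_prop)) (PT.eraseP (by fun_prop) (by fun_prop))
      (by fun_prop)
  · have := esize_eraseP_le (SATKernel.conflict a) s
    unfold cancelStep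
    split <;> simp <;> omega

@[fun_prop]
theorem PT.owns {i : γ → ℕ} {e : γ → Entry} (hi : PT i) (he : PT e) :
    PT (fun x => owns (i x) (e x)) := by
  unfold SATKernel.owns
  fun_prop

@[fun_prop]
theorem PT.cheapest {N i : γ → ℕ} {S : γ → List Entry} {e : γ → Entry} (hN : PT N) (hS : PT S)
    (hi : PT i) (he : PT e) : PT (fun x => cheapest (N x) (S x) (i x) (e x)) := by
  unfold SATKernel.cheapest
  exact PT.and (by fun_prop) (PT.all (by fun_prop) hS)

@[fun_prop]
theorem PT.bid {N i : γ → ℕ} {S : γ → List Entry} (hN : PT N) (hS : PT S)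
    (hi : PT i) : PT (fun x => bid (N x) (S x) (i x)) := by
  unfold SATKernel.bid
  exact PT.ite (PT.any (by fun_prop) hS) hS (PT.updFirst (by fun_prop) (by fun_prop) hS)

theorem esize_updFirst_le (p : α → Bool) (u : α → α) (K : ℕ) (hu : ∀ a, esize (u a) ≤ esize a + K)
    (l : List α) : esize (updFirst p u l) ≤ esize l + K := by
  induction l with
  | nil => simp [updFirst]
  | cons a l ih =>
    have := hu a
    unfold updFirst
    split <;> simp <;> omega

/-- One more unary mark costs two nodes, and the new owner is written once. The growth does not
depend on the state, which keeps iterated rounds polynomial. -/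
theorem esize_bid_le (N : ℕ) (S : List Entry) (i : ℕ) :
    esize (bid N S i) ≤ esize S + (2 + esize i) := by
  unfold bid
  split
  · omega
  · refine esize_updFirst_le _ _ _ (fun e => ?_) _
    obtain ⟨p, o, c⟩ := e
    simp
    omega

theorem esize_bidRound_le (n N : ℕ) (S : List Entry) :
    esize (bidRound n N S) ≤ esize S + n * (3 + 2 * n) := by
  have key : ∀ k ≤ n, esize (bidRound k N S) ≤ esize S + k * (3 + 2 * n) := by
    intro k hk
    induction k with
    | zero => simp [bidRound]
    | succ k ih =>
      have h1 := ih (by omega)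
      have h2 := esize_bid_le N (bidRound k N S) k
      have h3 : bidRound (k + 1) N S = bid N (bidRound k N S) k := by
        simp [bidRound, List.range_succ]
      rw [h3, Nat.succ_mul]
      simp only [esize_nat] at h2
      omega
  exact key n le_rfl

@[fun_prop]
theorem PT.bidRound {n N : γ → ℕ} {S : γ → List Entry} (hn : PT n) (hN : PT N) (hS : PT S) :
    PT (fun x => bidRound (n x) (N x) (S x)) := by
  refine PT.foldl (f := fun x S i => SATKernel.bid (N x) S i) (s := S) (by fun_prop) hS
    (by fun_prop) ⟨2 + X, fun c s a => ?_⟩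
  have := esize_bid_le (N c) s a
  simp only [eval_add, eval_ofNat, eval_X]
  omega

@[fun_prop]
theorem PT.auction {n : γ → ℕ} {l : γ → List RawClause} (hn : PT n) (hl : PT l) :
    PT (fun x => auction (n x) (l x)) := by
  obtain ⟨P, hP⟩ := hn.size_le
  refine PT.iterate (f := fun x => SATKernel.bidRound (n x) ((l x).length + 1)) (by fun_prop)
    (PT.map (by fun_prop) hl) (by fun_prop) ⟨P * (3 + 2 * P), fun c s => ?_⟩
  refine (esize_bidRound_le _ _ _).trans ?_
  have : n c ≤ P.eval (esize c) := by
    have := hP c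
    simp at this
    omega
  simp only [eval_mul, eval_add, eval_ofNat]
  gcongr

@[fun_prop]
theorem PT.priceGap {S : γ → List Entry} (hS : PT S) : PT (fun x => priceGap (S x)) := by
  unfold SATKernel.priceGap
  exact PT.headD (PT.filter (PT.all (by fun_prop) (by fun_prop)) (by fun_prop)) (by fun_prop)

@[fun_prop]
theorem PT.owners {n : γ → ℕ} {S : γ → List Entry} (hn : PT n) (hS : PT S) :
    PT (fun x => owners (n x) (S x)) := by
  unfold SATKernel.owners
  exact PT.filter (PT.any (by fun_prop) (by fun_prop)) (by fun_prop)

@[fun_prop]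
theorem PT.keptLits {g j : γ → ℕ} {e : γ → Entry} (hg : PT g) (he : PT e) (hj : PT j) :
    PT (fun x => keptLits (g x) (e x) (j x)) := by
  unfold SATKernel.keptLits
  fun_prop

@[fun_prop]
theorem PT.reduceOwned {n : γ → ℕ} {l : γ → List RawClause} (hn : PT n) (hl : PT l) :
    PT (fun x => reduceOwned (n x) (l x)) := by
  unfold SATKernel.reduceOwned
  exact PT.prodMk (by fun_prop) (PT.map (PT.map (by fun_prop) (by fun_prop)) (by fun_prop))

@[fun_prop]
theorem PT.cappedVal {N : γ → ℕ} {l : γ → List Bool} (hN : PT N) (hl : PT l) :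
    PT (fun x => cappedVal (N x) (l x)) := by
  obtain ⟨P, hP⟩ := hN.size_le
  -- The cap keeps the unary accumulator at most `N x`; an uncapped binary number could have
  -- exponential unary size.
  refine PT.foldl_bounded (f := fun x (v : ℕ) (b : Bool) => Min.min (N x) (2 * v + b.toNat))
    (by fun_prop) (by fun_prop) (by fun_prop) ⟨P, fun c s a => ?_⟩
  have h1 := (hP c).trans (eval_mono P (Nat.le_add_right (esize c) (esize a)))
  simp at *
  omega

@[fun_prop]
theorem PT.fits {k : γ → ℕ} {F : γ → ℕ × List RawClause} (hk : PT k) (hF : PT F) :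
    PT (fun x => fits (k x) (F x)) := by
  unfold SATKernel.fits
  fun_prop

theorem PT.kernel : PT kernel := by
  unfold SATKernel.kernel
  fun_prop

end

end SATKernel

namespace SATKernel

open CNF Finset

/-! ### Bounds on the number of satisfied clauses -/

section
variable {n : ℕ} {ι : Type} [Fintype ι]

/-- Two assignments `α`, `β` are built so that each clause is satisfied by at least one of them, and
the clauses satisfied by both involve all variables. Each clause is represented by two of its
literals `l`, `l'`, equal only for unit clauses, with `l` on the owner if there is one. So at least
n/2 clauses count twice, and the better assignment satisfies at least m/2 + n/4 clauses. -/
theorem two_mul_card_add_le (c : ι → Clause n) (hne : ∀ a, (c a).Nonempty)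
    (hucf : ∀ a b i, c a = {(i, true)} → c b ≠ {(i, false)})
    (own : Fin n → ι) (hinj : own.Injective) (hocc : ∀ i, ∃ b, (i, b) ∈ c (own i)) :
    ∃ α, 2 * Fintype.card ι + n ≤ 4 * #{a | Satisfies α (c a)} := by
  classical
  have h1 : ∀ a, ∃ l l', l ∈ c a ∧ l' ∈ c a ∧ (l = l' → c a = {l}) ∧ ∀ i, own i = a → l.1 = i := by
    intro a
    have h2 : ∃ l ∈ c a, ∀ i, own i = a → l.1 = i := by
      by_cases h : ∃ i, own i = a
      · obtain ⟨i, rfl⟩ := h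
        obtain ⟨b, hb⟩ := hocc i
        exact ⟨_, hb, fun j hj => (hinj hj).symm⟩
      · obtain ⟨l, hl⟩ := hne a
        exact ⟨l, hl, fun i hi => (h ⟨i, hi⟩).elim⟩
    obtain ⟨l, hl, hl'⟩ := h2
    by_cases h : ∃ l' ∈ c a, l' ≠ l
    · obtain ⟨l', h3, h4⟩ := h
      exact ⟨l, l', hl, h3, fun h => (h4 h.symm).elim, hl'⟩
    · push Not at h
      exact ⟨l, l, hl, hl, fun _ => Finset.eq_singleton_iff_unique_mem.2 ⟨hl, h⟩, hl'⟩
  choose l l' hl hl' hunit hown using h1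
  let vars : ι → Finset (Fin n) := fun a => {(l a).1, (l' a).1}
  have hvl : ∀ a, (l a).1 ∈ vars a := fun a => by simp [vars]
  have hvl' : ∀ a, (l' a).1 ∈ vars a := fun a => by simp [vars]
  -- `M` will be a maximum packing of non-unit clauses with disjoint sets `vars`; by maximality
  -- every non-unit clause meets a covered variable.
  let good : Finset ι → Prop := fun M => (∀ a ∈ M, l a ≠ l' a) ∧
    ∀ a ∈ M, ∀ b ∈ M, ∀ x, x ∈ vars a → x ∈ vars b → a = b
  obtain ⟨M, hM, hmax⟩ := Finset.exists_max_image (univ.filter good) Finset.card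
    ⟨∅, by simp [good]⟩
  obtain ⟨hM1, hM2⟩ := (Finset.mem_filter.1 hM).2
  let cov : Fin n → Prop := fun x => ∃ b ∈ M, x ∈ vars b
  have hcov : ∀ a, l a ≠ l' a → ∃ x ∈ vars a, cov x := by
    intro a ha
    by_contra! h
    have haM : a ∉ M := fun h' => h _ (hvl a) ⟨a, h', hvl a⟩
    have : good (insert a M) := by
      refine ⟨fun b hb => ?_, fun b hb d hd x hx hx' => ?_⟩
      · rcases Finset.mem_insert.1 hb with rfl | hb
        · exact ha
        · exact hM1 b hb
      · rcases Finset.mem_insert.1 hb with rfl | hb' <;> rcases Finset.mem_insert.1 hd with rfl | hd'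
        · rfl
        · exact (h x hx ⟨d, hd', hx'⟩).elim
        · exact (h x hx' ⟨b, hb', hx⟩).elim
        · exact hM2 b hb' d hd' x hx hx'
    have := hmax _ (Finset.mem_filter.2 ⟨Finset.mem_univ _, this⟩)
    rw [Finset.card_insert_of_notMem haM] at this
    omega
  have hll : ∀ b ∈ M, ∀ a ∈ M, (l b).1 = (l a).1 → b = a := fun b hb a ha h =>
    hM2 b hb a ha (l a).1 (h ▸ hvl b) (hvl a)
  have hll' : ∀ b ∈ M, ∀ a ∈ M, (l' b).1 = (l' a).1 → b = a := fun b hb a ha h =>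
    hM2 b hb a ha (l' a).1 (h ▸ hvl' b) (hvl' a)
  have h0 : ∃ α₀ : Fin n → Bool, ∀ a ∈ M, (l a).1 ≠ (l' a).1 →
      α₀ (l a).1 = (l a).2 ∧ α₀ (l' a).1 = !(l' a).2 := by
    refine ⟨fun x => if h : ∃ a ∈ M, (l a).1 = x then (l h.choose).2 else
      if h : ∃ a ∈ M, (l' a).1 = x then !(l' h.choose).2 else false, fun a ha hne => ⟨?_, ?_⟩⟩
    · have h : ∃ b ∈ M, (l b).1 = (l a).1 := ⟨a, ha, rfl⟩
      have h3 := hll _ h.choose_spec.1 a ha h.choose_spec.2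
      simp only [dif_pos h, h3]
    · have h : ¬∃ b ∈ M, (l b).1 = (l' a).1 := by
        rintro ⟨b, hb, hb'⟩
        have := hM2 b hb a ha _ (hvl b) (hb' ▸ hvl' a)
        exact hne (this ▸ hb')
      have h' : ∃ b ∈ M, (l' b).1 = (l' a).1 := ⟨a, ha, rfl⟩
      have h3 := hll' _ h'.choose_spec.1 a ha h'.choose_spec.2
      simp only [dif_neg h, dif_pos h', h3]
  obtain ⟨α₀, hα₀⟩ := h0
  let U : Fin n → Prop := fun x => ∃ b a, c a = {(x, b)}
  -- An uncovered variable obeys its unit clause if it has one; otherwise it makes exactly one of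
  -- `l`, `l'` true in the clause it owns. Then `β` flips everything except the uncovered variables
  -- with unit clauses.
  let α : Fin n → Bool := fun x => if cov x then α₀ x else if h : U x then h.choose else
    if α₀ (l' (own x)).1 = (l' (own x)).2 then !(l (own x)).2 else (l (own x)).2
  let β : Fin n → Bool := fun x => if cov x ∨ ¬U x then !α x else α x
  have hαcov : ∀ x, cov x → α x = α₀ x := fun x h => by simp only [α, if_pos h]
  have hβ : ∀ x, cov x ∨ ¬U x → β x = !α x := fun x h => by simp only [β, if_pos h]
  have hflip : ∀ a, ∀ k ∈ c a, (cov k.1 ∨ ¬U k.1) → Satisfies α (c a) ∨ Satisfies β (c a) := by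
    intro a k hk h
    by_cases h3 : α k.1 = k.2
    · exact Or.inl ⟨k, hk, h3⟩
    · refine Or.inr ⟨k, hk, ?_⟩
      rw [hβ _ h]
      revert h3
      cases α k.1 <;> cases k.2 <;> simp
  have hboth : ∀ a, l a ≠ l' a → (l a).1 = (l' a).1 → Satisfies α (c a) ∧ Satisfies β (c a) := by
    intro a h h3
    have h4 : (l' a).2 = !(l a).2 := by
      have : (l a).2 ≠ (l' a).2 := fun h4 => h (Prod.ext h3 h4)
      revert this
      cases (l a).2 <;> cases (l' a).2 <;> simp
    have : ∀ γ : Fin n → Bool, Satisfies γ (c a) := by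
      intro γ
      by_cases h5 : γ (l a).1 = (l a).2
      · exact ⟨_, hl a, h5⟩
      · refine ⟨_, hl' a, ?_⟩
        rw [← h3, h4]
        revert h5
        cases γ (l a).1 <;> cases (l a).2 <;> simp
    exact ⟨this α, this β⟩
  have hUα : ∀ x, U x → ¬cov x → ∀ b a, c a = {(x, b)} → α x = b ∧ β x = b := by
    intro x hU hc b a ha
    have h3 : α x = hU.choose := by simp only [α, if_neg hc, dif_pos hU]
    have h4 : β x = α x := by simp only [β]; exact if_neg (by simp [hc, hU])
    obtain ⟨a', ha'⟩ := hU.choose_spec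
    rw [h4, h3]
    generalize hU.choose = b' at *
    cases b <;> cases b'
    · simp
    · exact (hucf _ _ _ ha' ha).elim
    · exact (hucf _ _ _ ha ha').elim
    · simp
  have honce : ∀ a, Satisfies α (c a) ∨ Satisfies β (c a) := by
    intro a
    by_cases h : l a = l' a
    · have h3 := hunit a h
      by_cases h4 : cov (l a).1
      · exact hflip a _ (hl a) (Or.inl h4)
      · exact Or.inl ⟨_, hl a, (hUα _ ⟨(l a).2, a, h3⟩ h4 _ a h3).1⟩
    · obtain ⟨x, hx, hx'⟩ := hcov a h
      simp only [vars, Finset.mem_insert, Finset.mem_singleton] at hx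
      rcases hx with rfl | rfl
      · exact hflip a _ (hl a) (Or.inl hx')
      · exact hflip a _ (hl' a) (Or.inl hx')
  -- The doubly satisfied clause at `x` is its clause in the packing, its unit clause, or the clause
  -- it owns.
  have htwice : ∀ x, ∃ a, (Satisfies α (c a) ∧ Satisfies β (c a)) ∧ x ∈ vars a := by
    intro x
    by_cases hx : cov x
    · obtain ⟨a, ha, hxa⟩ := hx
      refine ⟨a, ?_, hxa⟩
      by_cases h3 : (l a).1 = (l' a).1
      · exact hboth a (hM1 a ha) h3
      · obtain ⟨h4, h5⟩ := hα₀ a ha h3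
        refine ⟨⟨_, hl a, ?_⟩, ⟨_, hl' a, ?_⟩⟩
        · rw [hαcov _ ⟨a, ha, hvl a⟩, h4]
        · rw [hβ _ (Or.inl ⟨a, ha, hvl' a⟩), hαcov _ ⟨a, ha, hvl' a⟩, h5, Bool.not_not]
    · by_cases hU : U x
      · obtain ⟨b, a, ha⟩ := id hU
        have h3 := hUα x hU hx b a ha
        have h4 : (x, b) ∈ c a := by simp [ha]
        refine ⟨a, ⟨⟨_, h4, h3.1⟩, ⟨_, h4, h3.2⟩⟩, ?_⟩
        have := hl a
        rw [ha, Finset.mem_singleton] at this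
        simp [vars, this]
      · have hlx := hown _ x rfl
        refine ⟨own x, ?_, by simp [vars, hlx]⟩
        have hn : l (own x) ≠ l' (own x) := fun h => hU ⟨(l (own x)).2, own x, by
          rw [hunit _ h]; simp [Prod.ext_iff, hlx]⟩
        by_cases h3 : (l (own x)).1 = (l' (own x)).1
        · exact hboth _ hn h3
        have hy : cov (l' (own x)).1 := by
          obtain ⟨y, hy, hy'⟩ := hcov _ hn
          simp only [vars, Finset.mem_insert, Finset.mem_singleton] at hy
          rcases hy with rfl | rfl
          · rw [hlx] at hy'; exact (hx hy').elim
          · exact hy'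
        have h4 : α x = if α₀ (l' (own x)).1 = (l' (own x)).2 then !(l (own x)).2 else (l (own x)).2 := by
          simp only [α, if_neg hx, dif_neg hU]
        have h5 := hαcov _ hy
        by_cases h6 : α₀ (l' (own x)).1 = (l' (own x)).2
        · refine ⟨⟨_, hl' _, by rw [h5, h6]⟩, ⟨_, hl _, ?_⟩⟩
          rw [hlx, hβ x (Or.inr hU), h4, if_pos h6, Bool.not_not]
        · refine ⟨⟨_, hl _, by rw [hlx, h4, if_neg h6]⟩, ⟨_, hl' _, ?_⟩⟩
          rw [hβ _ (Or.inl hy), h5]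
          revert h6
          cases α₀ (l' (own x)).1 <;> cases (l' (own x)).2 <;> simp
  have hcard := Finset.card_union_add_card_inter (univ.filter fun a => Satisfies α (c a))
    (univ.filter fun a => Satisfies β (c a))
  rw [← Finset.filter_or, ← Finset.filter_and, Finset.filter_true_of_mem (fun a _ => honce a),
    Finset.card_univ] at hcard
  -- Each doubly satisfied clause accounts for at most two variables.
  have hn : n ≤ #{a | Satisfies α (c a) ∧ Satisfies β (c a)} * 2 := by
    have h3 : (univ : Finset (Fin n)) ⊆
        (univ.filter fun a => Satisfies α (c a) ∧ Satisfies β (c a)).biUnion vars := by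
      intro x _
      obtain ⟨a, ha, hxa⟩ := htwice x
      exact Finset.mem_biUnion.2 ⟨a, by simpa using ha, hxa⟩
    calc n = (univ : Finset (Fin n)).card := by simp
      _ ≤ _ := Finset.card_le_card h3
      _ ≤ _ := Finset.card_biUnion_le_card_mul _ _ _ fun a _ => Finset.card_le_two
  rcases le_total #{a | Satisfies α (c a)} #{a | Satisfies β (c a)} with h | h
  · exact ⟨β, by omega⟩
  · exact ⟨α, by omega⟩

/-- Sums over assignments factor over the variables, which gives total mass and marginals of a
product distribution. -/
theorem sum_prod_eq (g : Fin n → Bool → ℝ) :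
    ∑ α : Fin n → Bool, ∏ i, g i (α i) = ∏ i, (g i true + g i false) := by
  have := Finset.prod_univ_sum (fun _ : Fin n => (univ : Finset Bool)) g
  simp only [Fintype.piFinset_univ, Fintype.sum_bool] at this
  exact this.symm

/-- The bound of Lieberherr and Specker for formulas without conflicting unit clauses. -/
theorem golden_mul_card_le (c : ι → Clause n) (hne : ∀ a, (c a).Nonempty)
    (hucf : ∀ a b i, c a = {(i, true)} → c b ≠ {(i, false)}) :
    ∃ α, (Real.sqrt 5 - 1) / 2 * Fintype.card ι ≤ (#{a | Satisfies α (c a)} : ℝ) := by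
  classical
  obtain ⟨φ, hφ⟩ : ∃ φ, φ = (Real.sqrt 5 - 1) / 2 := ⟨_, rfl⟩
  have h5 : Real.sqrt 5 ^ 2 = 5 := Real.sq_sqrt (by norm_num)
  have h5' : 2 < Real.sqrt 5 := Real.lt_sqrt_of_sq_lt (by norm_num)
  have h5'' : Real.sqrt 5 < 3 := (Real.sqrt_lt' (by norm_num)).2 (by norm_num)
  -- This equation balances the two kinds of clauses: a unit clause holds with probability φ, and
  -- two literals on different variables fail together with probability at most φ² = 1 − φ.
  have hφ2 : φ * φ = 1 - φ := by rw [hφ]; nlinarith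
  have hφ0 : 1 / 2 < φ := by rw [hφ]; linarith
  have hφ1 : φ < 1 := by rw [hφ]; linarith
  rw [← hφ]
  -- The value favoured with probability φ is the one demanded by a unit clause; in the absence of a
  -- positive unit clause it is false.
  let s : Fin n → Bool := fun i => decide (∃ a, c a = {(i, true)})
  let w : Fin n → Bool → ℝ := fun i b => if b = s i then φ else 1 - φ
  have hw0 : ∀ i b, 0 < w i b := fun i b => by simp only [w]; split <;> linarith
  have hwφ : ∀ i b, w i b ≤ φ := fun i b => by simp only [w]; split <;> linarith
  have hw1 : ∀ i, w i true + w i false = 1 := fun i => by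
    simp only [w]; cases s i <;> simp
  let W : (Fin n → Bool) → ℝ := fun α => ∏ i, w i (α i)
  have hW0 : ∀ α, 0 < W α := fun α => Finset.prod_pos fun i _ => hw0 _ _
  have hW1 : ∑ α, W α = 1 := by
    rw [sum_prod_eq]; simp [hw1]
  have hone : ∀ k : Fin n × Bool, ∑ α, (if α k.1 = k.2 then W α else 0) = w k.1 k.2 := by
    rintro ⟨i, b⟩
    -- An indicator factor at coordinate `i` turns the total mass into a marginal.
    have h := sum_prod_eq (fun j d => w j d * (if j = i then (if d = b then 1 else 0) else 1))
    have h3 : ∀ j, w j true * (if j = i then (if true = b then (1 : ℝ) else 0) else 1) +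
        w j false * (if j = i then (if false = b then 1 else 0) else 1)
        = if j = i then w i b else 1 := by
      intro j
      by_cases hj : j = i
      · subst hj; cases b <;> simp
      · simp [hj, hw1]
    simp only [h3, Finset.prod_ite_eq', Finset.mem_univ, if_true] at h
    rw [← h]
    refine Finset.sum_congr rfl fun α _ => ?_
    rw [Finset.prod_mul_distrib, Finset.prod_ite_eq']
    simp [W]
  have htwo : ∀ k k' : Fin n × Bool, k.1 ≠ k'.1 →
      ∑ α, (if α k.1 = k.2 ∧ α k'.1 = k'.2 then W α else 0) = w k.1 k.2 * w k'.1 k'.2 := by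
    rintro ⟨i, b⟩ ⟨i', b'⟩ hii
    have h := sum_prod_eq (fun j d => w j d * (if j = i then (if d = b then 1 else 0) else 1) *
      (if j = i' then (if d = b' then 1 else 0) else 1))
    have h3 : ∀ j, w j true * (if j = i then (if true = b then (1 : ℝ) else 0) else 1) *
        (if j = i' then (if true = b' then 1 else 0) else 1) +
        w j false * (if j = i then (if false = b then 1 else 0) else 1) *
        (if j = i' then (if false = b' then 1 else 0) else 1)
        = (if j = i then w i b else 1) * (if j = i' then w i' b' else 1) := by
      intro j
      by_cases hj : j = i
      · subst hj
        have : j ≠ i' := hii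
        cases b <;> simp [this]
      · by_cases hj' : j = i'
        · subst hj'; cases b' <;> simp [hj]
        · simp [hj, hj', hw1]
    simp only [h3, Finset.prod_mul_distrib, Finset.prod_ite_eq', Finset.mem_univ, if_true] at h
    rw [← h]
    refine Finset.sum_congr rfl fun α _ => ?_
    simp only [W]
    split <;> rename_i hc
    · simp [hc.1, hc.2]
    · rw [not_and_or] at hc
      rcases hc with hc | hc <;> simp [hc]
  have hclause : ∀ a, φ ≤ ∑ α, (if Satisfies α (c a) then W α else 0) := by
    intro a
    obtain ⟨k, hk⟩ := hne a
    by_cases hu : ∃ k' ∈ c a, k' ≠ k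
    · obtain ⟨k', hk', hkk⟩ := hu
      have h3 : ∑ α, (if Satisfies α (c a) then W α else 0) =
          1 - ∑ α, (if ¬Satisfies α (c a) then W α else 0) := by
        rw [← hW1, eq_sub_iff_add_eq, ← Finset.sum_add_distrib]
        refine Finset.sum_congr rfl fun α _ => ?_
        split <;> simp_all
      rw [h3]
      suffices ∑ α, (if ¬Satisfies α (c a) then W α else 0) ≤ φ * φ by linarith
      by_cases hv : k.1 = k'.1
      · rw [Finset.sum_eq_zero]
        · nlinarith
        · intro α _
          rw [if_neg]
          rw [not_not]
          by_cases h4 : α k.1 = k.2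
          · exact ⟨k, hk, h4⟩
          · refine ⟨k', hk', ?_⟩
            have : k'.2 ≠ k.2 := fun h => hkk (Prod.ext hv.symm h)
            rw [← hv]
            revert h4 this
            cases α k.1 <;> cases k.2 <;> cases k'.2 <;> simp
      · calc _ ≤ ∑ α, (if α k.1 = !k.2 ∧ α k'.1 = !k'.2 then W α else 0) := by
              refine Finset.sum_le_sum fun α _ => ?_
              split <;> rename_i h4
              · rw [if_pos]
                refine ⟨?_, ?_⟩
                · have : α k.1 ≠ k.2 := fun h => h4 ⟨k, hk, h⟩
                  revert this
                  cases α k.1 <;> cases k.2 <;> simp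
                · have : α k'.1 ≠ k'.2 := fun h => h4 ⟨k', hk', h⟩
                  revert this
                  cases α k'.1 <;> cases k'.2 <;> simp
              · split
                · exact (hW0 α).le
                · exact le_rfl
          _ = w k.1 (!k.2) * w k'.1 (!k'.2) := htwo (k.1, !k.2) (k'.1, !k'.2) hv
          _ ≤ φ * φ := mul_le_mul (hwφ _ _) (hwφ _ _) (hw0 _ _).le (by linarith)
    · push Not at hu
      have hck : c a = {k} := Finset.eq_singleton_iff_unique_mem.2 ⟨hk, hu⟩
      have hs : k.2 = s k.1 := by
        obtain ⟨i, b⟩ := k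
        cases b
        · have : ¬∃ a, c a = {(i, true)} := fun ⟨a', ha'⟩ => hucf a' a i ha' hck
          simp [s, this]
        · have : ∃ a, c a = {(i, true)} := ⟨a, hck⟩
          simp [s, this]
      have h3 := hone k
      have h4 : w k.1 k.2 = φ := by simp only [w, if_pos hs]
      rw [h4] at h3
      refine le_of_eq ?_
      rw [← h3]
      refine Finset.sum_congr rfl fun α _ => ?_
      congr 1
      simp [Satisfies, hck]
  by_contra! hlt
  -- If every assignment fell short, so would the expected number of satisfied clauses.
  have h3 : ∑ α, W α * (#{a | Satisfies α (c a)} : ℝ) < ∑ α, W α * (φ * Fintype.card ι) :=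
    Finset.sum_lt_sum_of_nonempty Finset.univ_nonempty fun α _ =>
      mul_lt_mul_of_pos_left (hlt α) (hW0 α)
  rw [← Finset.sum_mul, hW1, one_mul] at h3
  have h4 : ∑ α, W α * (#{a | Satisfies α (c a)} : ℝ)
      = ∑ a, ∑ α, (if Satisfies α (c a) then W α else 0) := by
    rw [Finset.sum_comm]
    refine Finset.sum_congr rfl fun α _ => ?_
    rw [← Finset.sum_filter, Finset.sum_const, nsmul_eq_mul, mul_comm]
  rw [h4] at h3
  have h6 : ∑ _a : ι, φ ≤ ∑ a, ∑ α, (if Satisfies α (c a) then W α else 0) :=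
    Finset.sum_le_sum fun a _ => hclause a
  rw [Finset.sum_const, nsmul_eq_mul, Finset.card_univ] at h6
  linarith

end

end SATKernel

namespace SATKernel

/-! ### Correctness of the algorithm -/

/-- The variable `i` occurs in the clause with sign `b`. -/
def HasLit (c : RawClause) (i : ℕ) (b : Bool) : Prop := cond b (lits c i).1 (lits c i).2 = true

instance (c : RawClause) (i : ℕ) (b : Bool) : Decidable (HasLit c i b) :=
  inferInstanceAs (Decidable (_ = true))

/-- An assignment satisfies a clause. -/
def rawSat (α : ℕ → Bool) (c : RawClause) : Bool :=
  (List.range c.length).any fun i => decide (HasLit c i (α i))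

/-- The only literal of the clause is the variable `i` with sign `b`. -/
def IsUnitAt (c : RawClause) (i : ℕ) (b : Bool) : Prop :=
  HasLit c i b ∧ ∀ j d, HasLit c j d → j = i ∧ d = b

/-- There is no pair of conflicting unit clauses. -/
def ConflictFree (l : List RawClause) : Prop := ∀ c ∈ l, ∀ d ∈ l, conflict c d = false

/-- The number of satisfied clauses can exceed half of the number of clauses by `k`. -/
def AboveHalf (l : List RawClause) (k : ℕ) : Prop :=
  ∃ α : ℕ → Bool, l.length + 2 * k ≤ 2 * l.countP (rawSat α)

theorem HasLit.lt_length {c : RawClause} {i : ℕ} {b : Bool} (h : HasLit c i b) : i < c.length := by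
  by_contra hi
  have : lits c i = (false, false) := List.getD_eq_default _ _ (not_lt.1 hi)
  unfold HasLit at h
  rw [this] at h
  cases b <;> simp at h

theorem rawSat_iff {α : ℕ → Bool} {c : RawClause} : rawSat α c = true ↔ ∃ i, HasLit c i (α i) := by
  simp only [rawSat, List.any_eq_true, List.mem_range, decide_eq_true_eq]
  exact ⟨fun ⟨i, _, h⟩ => ⟨i, h⟩, fun ⟨i, h⟩ => ⟨i, h.lt_length, h⟩⟩

theorem occurs_iff {c : RawClause} {i : ℕ} : occurs c i = true ↔ ∃ b, HasLit c i b := by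
  simp [occurs, HasLit, or_comm]

theorem hasLit_cons_zero {p : Bool × Bool} {c : RawClause} {b : Bool} :
    HasLit (p :: c) 0 b ↔ cond b p.1 p.2 = true := Iff.rfl

theorem not_hasLit_nil {i : ℕ} {b : Bool} : ¬HasLit [] i b := by
  intro h
  simpa using h.lt_length

theorem numLits_cons (p : Bool × Bool) (c : RawClause) :
    numLits (p :: c) = (p.1.toNat + p.2.toNat) + numLits c := by
  have key : ∀ (c : RawClause) (s : ℕ), c.foldl (fun s p => s + (p.1.toNat + p.2.toNat)) s
      = s + numLits c := by
    intro c
    induction c with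
    | nil => simp [numLits]
    | cons p c ih =>
      intro s
      have h : numLits (p :: c) = 0 + (p.1.toNat + p.2.toNat) + numLits c := ih _
      rw [List.foldl_cons, ih, h]
      omega
  rw [numLits, List.foldl_cons, key]
  omega

theorem numLits_eq_zero {c : RawClause} : numLits c = 0 ↔ ∀ i b, ¬HasLit c i b := by
  induction c with
  | nil => simp [numLits, not_hasLit_nil]
  | cons p c ih =>
    rw [numLits_cons, Nat.add_eq_zero_iff, ih]
    constructor
    · rintro ⟨h1, h2⟩ i b
      cases i with
      | zero => rw [hasLit_cons_zero]; rcases p with ⟨_ | _, _ | _⟩ <;> cases b <;> simp at *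
      | succ i => exact h2 i b
    · intro h
      refine ⟨?_, fun i b => h (i + 1) b⟩
      have h1 := h 0 true
      have h2 := h 0 false
      rw [hasLit_cons_zero] at h1 h2
      rcases p with ⟨_ | _, _ | _⟩ <;> simp at *

theorem numLits_eq_one {c : RawClause} : numLits c = 1 ↔ ∃ i b, IsUnitAt c i b := by
  induction c with
  | nil => simp [numLits, IsUnitAt, not_hasLit_nil]
  | cons p c ih =>
    rw [numLits_cons]
    have hp : p.1.toNat + p.2.toNat = 0 ↔ p = (false, false) := by
      rcases p with ⟨_ | _, _ | _⟩ <;> simp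
    constructor
    · intro h
      by_cases h0 : numLits c = 0
      · rw [numLits_eq_zero] at h0
        have h1 : p = (true, false) ∨ p = (false, true) := by
          rw [numLits_eq_zero.2 h0] at h
          rcases p with ⟨_ | _, _ | _⟩ <;> simp at *
        rcases h1 with rfl | rfl
        · refine ⟨0, true, rfl, fun j d hj => ?_⟩
          cases j with
          | zero => rw [hasLit_cons_zero] at hj; cases d <;> simp at *
          | succ j => exact (h0 j d hj).elim
        · refine ⟨0, false, rfl, fun j d hj => ?_⟩
          cases j with
          | zero => rw [hasLit_cons_zero] at hj; cases d <;> simp at *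
          | succ j => exact (h0 j d hj).elim
      · obtain ⟨i, b, h1, h2⟩ := ih.1 (by omega)
        have h3 := hp.1 (by omega)
        refine ⟨i + 1, b, h1, fun j d hj => ?_⟩
        cases j with
        | zero => rw [hasLit_cons_zero, h3] at hj; cases d <;> simp at hj
        | succ j => have := h2 j d hj; simpa using this
    · rintro ⟨i, b, h1, h2⟩
      cases i with
      | zero =>
        have h3 : numLits c = 0 := numLits_eq_zero.2 fun j d hj => by
          have := h2 (j + 1) d hj
          omega
        rw [h3]
        rw [hasLit_cons_zero] at h1
        have h4 := h2 0 (!b)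
        rw [hasLit_cons_zero] at h4
        rcases p with ⟨_ | _, _ | _⟩ <;> cases b <;> simp at *
      | succ i =>
        have h3 := ih.2 ⟨i, b, h1, fun j d hj => by have := h2 (j + 1) d hj; simpa using this⟩
        rw [h3]
        have h4 := h2 0 true
        have h5 := h2 0 false
        rw [hasLit_cons_zero] at h4 h5
        rcases p with ⟨_ | _, _ | _⟩ <;> simp at *

theorem conflict_iff {c d : RawClause} :
    conflict c d = true ↔ ∃ i b, IsUnitAt c i b ∧ IsUnitAt d i !b := by
  simp only [conflict, Bool.and_eq_true, decide_eq_true_eq, numLits_eq_one, List.any_eq_true,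
    List.mem_range, Bool.or_eq_true]
  constructor
  · rintro ⟨⟨⟨i, b, hc⟩, ⟨i', b', hd⟩⟩, j, _, h⟩
    have h1 : ∃ e, HasLit c j e ∧ HasLit d j !e := by
      rcases h with h | h
      · exact ⟨true, h⟩
      · exact ⟨false, h⟩
    obtain ⟨e, h1, h2⟩ := h1
    obtain ⟨rfl, rfl⟩ := hc.2 _ _ h1
    obtain ⟨rfl, rfl⟩ := hd.2 _ _ h2
    exact ⟨_, _, hc, hd⟩
  · rintro ⟨i, b, hc, hd⟩
    refine ⟨⟨⟨i, b, hc⟩, ⟨i, _, hd⟩⟩, i, hc.1.lt_length, ?_⟩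
    have h1 := hc.1
    have h2 := hd.1
    cases b
    · exact Or.inr ⟨h1, h2⟩
    · exact Or.inl ⟨h1, h2⟩

theorem conflict_comm {c d : RawClause} : conflict c d = conflict d c := by
  rw [Bool.eq_iff_iff, conflict_iff, conflict_iff]
  constructor <;> rintro ⟨i, b, h1, h2⟩ <;> exact ⟨i, !b, h2, by rwa [Bool.not_not]⟩

theorem conflict_self (c : RawClause) : conflict c c = false := by
  by_contra h
  obtain ⟨i, b, h1, h2⟩ := conflict_iff.1 (by simpa using h)
  have := (h1.2 _ _ h2.1).2
  cases b <;> simp at this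

theorem IsUnitAt.rawSat_eq {c : RawClause} {i : ℕ} {b : Bool} (h : IsUnitAt c i b) (α : ℕ → Bool) :
    rawSat α c = decide (α i = b) := by
  rw [Bool.eq_iff_iff, rawSat_iff, decide_eq_true_eq]
  constructor
  · rintro ⟨j, hj⟩
    obtain ⟨rfl, hα⟩ := h.2 _ _ hj
    exact hα
  · intro hi
    exact ⟨i, by rw [hi]; exact h.1⟩

/-- `r` counts cancelled pairs. Any assignment satisfies exactly one clause of such a pair, so the
length drops by `2 * r` and the satisfied count by `r`. -/
theorem cancelStep_spec (l : List RawClause) (c : RawClause) (hl : ConflictFree l) :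
    ConflictFree (cancelStep l c) ∧ (∀ d ∈ cancelStep l c, d = c ∨ d ∈ l) ∧
    ∃ r, (cancelStep l c).length + 2 * r = l.length + 1 ∧
      ∀ α, (cancelStep l c).countP (rawSat α) + r = l.countP (rawSat α) + [c].countP (rawSat α) := by
  unfold cancelStep
  split
  · rename_i h
    obtain ⟨d, hd, hcd⟩ := List.any_eq_true.1 h
    obtain ⟨a, l₁, l₂, _, ha, hl', he⟩ := List.exists_of_eraseP hd hcd
    have hsub : ∀ d ∈ l.eraseP (conflict c), d ∈ l := fun d hd => List.mem_of_mem_eraseP hd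
    refine ⟨fun x hx y hy => hl x (hsub x hx) y (hsub y hy), fun d hd => Or.inr (hsub d hd), 1, ?_,
      fun α => ?_⟩
    · rw [he, hl']; simp; omega
    · obtain ⟨i, b, h1, h2⟩ := conflict_iff.1 ha
      rw [he, hl']
      simp only [List.countP_append, List.countP_cons, List.countP_nil, h1.rawSat_eq, h2.rawSat_eq]
      cases α i <;> cases b <;> simp <;> omega
  · rename_i h
    have h' : ∀ d ∈ l, conflict c d = false := by simpa using h
    refine ⟨fun x hx y hy => ?_, fun d hd => by simpa using hd, 0, by simp, fun α => ?_⟩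
    · rcases List.mem_cons.1 hx with rfl | hx' <;> rcases List.mem_cons.1 hy with rfl | hy'
      · exact conflict_self _
      · exact h' y hy'
      · rw [conflict_comm]; exact h' x hx'
      · exact hl x hx' y hy'
    · simp [List.countP_cons]

theorem cancelUnits_spec (l : List RawClause) :
    ConflictFree (cancelUnits l) ∧ (∀ d ∈ cancelUnits l, d ∈ l) ∧
    ∀ k, AboveHalf l k ↔ AboveHalf (cancelUnits l) k := by
  have key : ∀ (l s : List RawClause), ConflictFree s → ConflictFree (l.foldl cancelStep s) ∧
      (∀ d ∈ l.foldl cancelStep s, d ∈ l ∨ d ∈ s) ∧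
      ∃ r, (l.foldl cancelStep s).length + 2 * r = l.length + s.length ∧
        ∀ α, (l.foldl cancelStep s).countP (rawSat α) + r
          = l.countP (rawSat α) + s.countP (rawSat α) := by
    intro l
    induction l with
    | nil => intro s hs; exact ⟨hs, fun d hd => Or.inr hd, 0, by simp, fun α => by simp⟩
    | cons c l ih =>
      intro s hs
      obtain ⟨h1, h2, r, h3, h4⟩ := cancelStep_spec s c hs
      obtain ⟨h5, h6, r', h7, h8⟩ := ih _ h1
      refine ⟨h5, fun d hd => ?_, r + r', ?_, fun α => ?_⟩
      · rcases h6 d hd with h | h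
        · exact Or.inl (List.mem_cons_of_mem _ h)
        · rcases h2 d h with rfl | h
          · exact Or.inl List.mem_cons_self
          · exact Or.inr h
      · simp only [List.foldl_cons, List.length_cons]; omega
      · have h9 := h4 α
        have h10 := h8 α
        simp only [List.foldl_cons, List.countP_cons, List.countP_nil] at *
        omega
  obtain ⟨h1, h2, r, h3, h4⟩ := key l [] (by simp [ConflictFree])
  refine ⟨h1, fun d hd => by simpa using h2 d hd, fun k => ?_⟩
  refine exists_congr fun α => ?_
  have := h4 α
  change _ ↔ (l.foldl cancelStep []).length + 2 * k ≤ 2 * (l.foldl cancelStep []).countP _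
  simp only [List.length_nil, List.countP_nil] at *
  omega

/-! #### The auction -/

theorem updFirst_spec {α : Type} (p : α → Bool) (u : α → α) (l : List α) :
    ((∀ x ∈ l, p x = false) ∧ updFirst p u l = l) ∨
    ∃ A x B, l = A ++ x :: B ∧ p x = true ∧ updFirst p u l = A ++ u x :: B := by
  induction l with
  | nil => exact Or.inl ⟨by simp, rfl⟩
  | cons a l ih =>
    by_cases h : p a
    · exact Or.inr ⟨[], a, l, rfl, h, by simp [updFirst, h]⟩
    · rcases ih with ⟨h1, h2⟩ | ⟨A, x, B, h1, h2, h3⟩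
      · exact Or.inl ⟨by simpa [h] using h1, by simp [updFirst, h, h2]⟩
      · exact Or.inr ⟨a :: A, x, B, by simp [h1], h2, by simp [updFirst, h, h3]⟩

/-- The invariant of the auction of the clauses `l` with maximal price `N`. -/
structure AuctionInv (N : ℕ) (l : List RawClause) (S : List Entry) : Prop where
  clauses : S.map (fun e => e.2.2) = l
  occ : ∀ e ∈ S, 0 < e.1 → occurs e.2.2 e.2.1 = true
  near : ∀ e ∈ S, ∀ e' ∈ S, 0 < e.1 → occurs e'.2.2 e.2.1 = true → e.1 ≤ e'.1 + 1
  uniq : S.Pairwise fun e e' => 0 < e.1 → 0 < e'.1 → e.2.1 ≠ e'.2.1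
  le : ∀ e ∈ S, e.1 ≤ N

/-- The sum of the prices. -/
def totalPrice (S : List Entry) : ℕ := (S.map fun e => e.1).sum

theorem bid_eq_or (N : ℕ) (S : List Entry) (i : ℕ) :
    bid N S i = S ∨ ((∀ e ∈ S, owns i e = false) ∧ ∃ A x B, S = A ++ x :: B ∧
      cheapest N S i x = true ∧ bid N S i = A ++ (x.1 + 1, i, x.2.2) :: B) := by
  unfold bid
  split
  · exact Or.inl rfl
  · rename_i h
    rcases updFirst_spec (cheapest N S i) (fun e => (e.1 + 1, i, e.2.2)) S with h1 | ⟨A, x, B, h1, h2, h3⟩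
    · exact Or.inl h1.2
    · exact Or.inr ⟨by simpa using h, A, x, B, h1, h2, h3⟩

theorem cheapest_iff {N i : ℕ} {S : List Entry} {e : Entry} : cheapest N S i e = true ↔
    (occurs e.2.2 i = true ∧ e.1 < N) ∧ ∀ e' ∈ S, occurs e'.2.2 i = true → e.1 ≤ e'.1 := by
  simp only [cheapest, Bool.and_eq_true, decide_eq_true_eq, List.all_eq_true, Bool.or_eq_true,
    Bool.not_eq_true', imp_iff_not_or, Bool.not_eq_true]

theorem owns_iff {i : ℕ} {e : Entry} : owns i e = true ↔ 0 < e.1 ∧ e.2.1 = i := by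
  simp [owns]

/-- `near` survives because the buyer takes a cheapest clause containing it and prices only rise;
`uniq` survives because only a variable owning nothing buys, and the sale displaces the previous
owner. -/
theorem AuctionInv.bid {N : ℕ} {l : List RawClause} {S : List Entry} (h : AuctionInv N l S) (i : ℕ) :
    AuctionInv N l (bid N S i) := by
  rcases bid_eq_or N S i with h1 | ⟨hown, A, x, B, rfl, hx, h1⟩
  · rwa [h1]
  rw [h1]
  obtain ⟨⟨hx1, hx2⟩, hx3⟩ := cheapest_iff.1 hx
  have hown' : ∀ e ∈ A ++ x :: B, 0 < e.1 → e.2.1 ≠ i := fun e he h0 h1 => by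
    have := hown e he
    rw [owns_iff.2 ⟨h0, h1⟩] at this
    simp at this
  have hmem : ∀ e ∈ A ++ (x.1 + 1, i, x.2.2) :: B, e = (x.1 + 1, i, x.2.2) ∨ e ∈ A ++ x :: B := by
    intro e he
    simp only [List.mem_append, List.mem_cons] at *
    tauto
  have hxm : x ∈ A ++ x :: B := by simp
  refine ⟨?_, fun e he h0 => ?_, fun e he e' he' h0 ho => ?_, ?_, fun e he => ?_⟩
  · rw [← h.clauses]; simp
  · rcases hmem e he with rfl | he
    · exact hx1
    · exact h.occ e he h0
  · rcases hmem e he with rfl | he <;> rcases hmem e' he' with rfl | he'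
    · exact Nat.le_succ _
    · exact Nat.succ_le_succ (hx3 e' he' ho)
    · have := h.near e he x hxm h0 ho
      exact this.trans (Nat.le_succ _)
    · exact h.near e he e' he' h0 ho
  · have h2 := h.uniq
    rw [List.pairwise_append, List.pairwise_cons] at h2 ⊢
    obtain ⟨h3, ⟨h4, h5⟩, h6⟩ := h2
    refine ⟨h3, ⟨fun e he _ h0 => ?_, h5⟩, fun e he e' he' h0 h0' => ?_⟩
    · exact (hown' e (by simp [he]) h0).symm
    · rcases List.mem_cons.1 he' with rfl | he'
      · exact hown' e (by simp [he]) h0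
      · exact h6 e he e' (by simp [he']) h0 h0'
  · rcases hmem e he with rfl | he
    · exact hx2
    · exact h.le e he

theorem AuctionInv.bidRound {N : ℕ} {l : List RawClause} {S : List Entry} (h : AuctionInv N l S)
    (n : ℕ) : AuctionInv N l (bidRound n N S) := by
  unfold SATKernel.bidRound
  generalize List.range n = r
  induction r generalizing S with
  | nil => exact h
  | cons i r ih => exact ih (h.bid i)

theorem AuctionInv.start (N : ℕ) (l : List RawClause) :
    AuctionInv N l (l.map fun c => (0, 0, c)) := by
  refine ⟨by simp [Function.comp_def], ?_, ?_, ?_, ?_⟩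
  · simp
  · simp
  · rw [List.pairwise_map]; simp [List.pairwise_iff_getElem]
  · simp

theorem AuctionInv.totalPrice_le {N : ℕ} {l : List RawClause} {S : List Entry}
    (h : AuctionInv N l S) : totalPrice S ≤ l.length * N := by
  have := List.sum_le_card_nsmul (S.map fun e => e.1) N (by simpa using fun a b c he => h.le _ he)
  rw [← h.clauses]
  simpa [totalPrice] using this

theorem totalPrice_bid (N : ℕ) (S : List Entry) (i : ℕ) :
    bid N S i = S ∨ totalPrice (bid N S i) = totalPrice S + 1 := by
  rcases bid_eq_or N S i with h | ⟨_, A, x, B, rfl, _, h⟩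
  · exact Or.inl h
  · right
    rw [h]
    simp [totalPrice]
    omega

/-- The total price is a potential: a round that does not raise it contained no purchase. -/
theorem totalPrice_bidRound (n N : ℕ) (S : List Entry) :
    totalPrice S ≤ totalPrice (bidRound n N S) ∧
    (totalPrice (bidRound n N S) = totalPrice S →
      bidRound n N S = S ∧ ∀ i < n, bid N S i = S) := by
  induction n with
  | zero => simp [bidRound]
  | succ n ih =>
    have h : bidRound (n + 1) N S = bid N (bidRound n N S) n := by
      simp [bidRound, List.range_succ]
    rw [h]
    rcases totalPrice_bid N (bidRound n N S) n with h1 | h1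
    · rw [h1]
      refine ⟨ih.1, fun h2 => ?_⟩
      obtain ⟨h3, h4⟩ := ih.2 h2
      refine ⟨h3, fun i hi => ?_⟩
      rcases Nat.lt_succ_iff_lt_or_eq.1 hi with hi | rfl
      · exact h4 i hi
      · rwa [h3] at h1
    · refine ⟨by omega, fun h2 => ?_⟩
      omega

/-- With m clauses the total price never exceeds m(m + 1), and each round raises it until no
purchase is possible; m(m + 1) + 1 rounds therefore suffice. -/
theorem auction_spec (n : ℕ) (l : List RawClause) :
    AuctionInv (l.length + 1) l (auction n l) ∧
    ∀ i < n, bid (l.length + 1) (auction n l) i = auction n l := by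
  have hinv : ∀ t, AuctionInv (l.length + 1) l
      ((bidRound n (l.length + 1))^[t] (l.map fun c => (0, 0, c))) := by
    intro t
    induction t with
    | zero => exact AuctionInv.start _ _
    | succ t ih => rw [Function.iterate_succ_apply']; exact ih.bidRound n
  refine ⟨hinv _, ?_⟩
  have key : ∀ t, (∀ i < n, bid (l.length + 1) ((bidRound n (l.length + 1))^[t]
      (l.map fun c => (0, 0, c))) i = (bidRound n (l.length + 1))^[t] (l.map fun c => (0, 0, c))) ∨
      t ≤ totalPrice ((bidRound n (l.length + 1))^[t] (l.map fun c => (0, 0, c))) := by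
    intro t
    induction t with
    | zero => exact Or.inr (Nat.zero_le _)
    | succ t ih =>
      rw [Function.iterate_succ_apply']
      generalize (bidRound n (l.length + 1))^[t] (l.map fun c => (0, 0, c)) = S at *
      obtain ⟨h1, h2⟩ := totalPrice_bidRound n (l.length + 1) S
      by_cases h3 : totalPrice (bidRound n (l.length + 1) S) = totalPrice S
      · obtain ⟨h4, h5⟩ := h2 h3
        rw [h4]
        exact Or.inl h5
      · rcases ih with ih | ih
        · have : ∀ r : List ℕ, (∀ i ∈ r, i < n) → r.foldl (bid (l.length + 1)) S = S := by
            intro r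
            induction r with
            | nil => simp
            | cons i r ihr =>
              intro hr
              rw [List.foldl_cons, ih i (hr i List.mem_cons_self),
                ihr fun j hj => hr j (List.mem_cons_of_mem _ hj)]
          exact (h3 (congrArg totalPrice (this (List.range n) fun i hi => List.mem_range.1 hi))).elim
        · exact Or.inr (by omega)
  rcases key (l.length * (l.length + 1) + 1) with h | h
  · exact h
  · have := (hinv (l.length * (l.length + 1) + 1)).totalPrice_le
    omega

/-- A variable that owns nothing at the end of the auction occurs in expensive clauses only. -/
theorem le_price_of_bid_eq {N i : ℕ} {S : List Entry} (h : bid N S i = S)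
    (hi : ∀ e ∈ S, owns i e = false) : ∀ e ∈ S, occurs e.2.2 i = true → N ≤ e.1 := by
  intro e he ho
  by_contra! hlt
  obtain ⟨m, hm, hmin⟩ := Finset.exists_min_image (S.toFinset.filter fun e => occurs e.2.2 i = true)
    (fun e => e.1) ⟨e, by simp [he, ho]⟩
  simp only [Finset.mem_filter, List.mem_toFinset] at hm hmin
  have hc : cheapest N S i m = true := cheapest_iff.2
    ⟨⟨hm.2, (hmin e ⟨he, ho⟩).trans_lt hlt⟩, fun e' he' ho' => hmin e' ⟨he', ho'⟩⟩
  have hb : bid N S i = updFirst (cheapest N S i) (fun e => (e.1 + 1, i, e.2.2)) S := by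
    unfold bid
    rw [if_neg]
    simpa using hi
  rcases updFirst_spec (cheapest N S i) (fun e => (e.1 + 1, i, e.2.2)) S with h1 | ⟨A, x, B, h1, h2, h3⟩
  · have := h1.1 m hm.1
    rw [hc] at this
    simp at this
  -- A purchase would raise the total price, yet the state is fixed.
  · rw [← hb, h] at h3
    have h4 := congrArg totalPrice h3
    rw [h1] at h4
    simp [totalPrice] at h4

theorem priceGap_spec (S : List Entry) : priceGap S ≤ S.length ∧ ∀ e ∈ S, e.1 ≠ priceGap S := by
  have h1 : ∃ g ∈ Finset.range (S.length + 1), g ∉ (S.map fun e => e.1).toFinset := by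
    -- Pigeonhole: the entries cannot use up all `S.length + 1` candidate prices.
    refine Finset.exists_mem_notMem_of_card_lt_card ?_
    have := List.toFinset_card_le (S.map fun e => e.1)
    rw [List.length_map] at this
    rw [Finset.card_range]
    omega
  obtain ⟨g, hg, hg'⟩ := h1
  have h2 : priceGap S ∈ (List.range (S.length + 1)).filter fun g => S.all fun e => !decide (e.1 = g) := by
    unfold priceGap
    generalize hl : (List.range (S.length + 1)).filter (fun g => S.all fun e => !decide (e.1 = g)) = r
    cases r with
    | nil =>
      have : g ∈ (List.range (S.length + 1)).filter fun g => S.all fun e => !decide (e.1 = g) := by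
        refine List.mem_filter.2 ⟨by simpa using hg, ?_⟩
        simp only [List.all_eq_true, Bool.not_eq_true', decide_eq_false_iff_not]
        intro e he h
        exact hg' (by simpa using ⟨e.2.1, e.2.2, h ▸ he⟩)
      rw [hl] at this
      simp at this
    | cons a r => simp
  rw [List.mem_filter] at h2
  simp only [List.mem_range, List.all_eq_true, Bool.not_eq_true', decide_eq_false_iff_not] at h2
  exact ⟨by omega, h2.2⟩

end SATKernel

namespace SATKernel

/-! ### Reducing the formula at a price gap. -/

theorem hasLit_map {A : List ℕ} {f : ℕ → Bool × Bool} {j : ℕ} {b : Bool} :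
    HasLit (A.map f) j b ↔ ∃ h : j < A.length, cond b (f A[j]).1 (f A[j]).2 = true := by
  constructor
  · intro h
    have hj : j < A.length := by simpa using h.lt_length
    refine ⟨hj, ?_⟩
    have : lits (A.map f) j = f A[j] := by simp [lits, hj]
    unfold HasLit at h
    rwa [this] at h
  · rintro ⟨hj, h⟩
    have : lits (A.map f) j = f A[j] := by simp [lits, hj]
    unfold HasLit
    rwa [this]

/-- The literal of the variable `i` with sign `b` is kept. -/
def Kept (g : ℕ) (e : Entry) (i : ℕ) (b : Bool) : Prop :=
  cond b (keptLits g e i).1 (keptLits g e i).2 = true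

theorem kept_of_le {g : ℕ} {e : Entry} (h : e.1 ≤ g) {i : ℕ} {b : Bool} :
    Kept g e i b ↔ HasLit e.2.2 i b := by
  simp [Kept, keptLits, h, HasLit]

theorem Kept.hasLit {g : ℕ} {e : Entry} {i : ℕ} {b : Bool} (h : Kept g e i b) :
    HasLit e.2.2 i b := by
  unfold Kept keptLits at h
  unfold HasLit
  split at h
  · exact h
  · split at h <;> cases b <;> simp_all

theorem kept_of_gt {g : ℕ} {e : Entry} (h : g < e.1) (ho : occurs e.2.2 e.2.1 = true) :
    ∃ d, ∀ i b, Kept g e i b ↔ i = e.2.1 ∧ b = d := by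
  have h' : ¬e.1 ≤ g := not_le.2 h
  refine ⟨(lits e.2.2 e.2.1).1, fun i b => ?_⟩
  by_cases hi : i = e.2.1
  · subst hi
    unfold occurs at ho
    simp only [Kept, keptLits, h', decide_false, Bool.false_eq_true, if_false, decide_true, if_true]
    generalize lits e.2.2 e.2.1 = p at *
    rcases p with ⟨_ | _, _ | _⟩ <;> cases b <;> simp at *
  · cases b <;> simp [Kept, keptLits, h', hi]

/-- The state of a finished auction among `n` variables, with a price `g` that does not occur. -/
structure Settled (n g : ℕ) (l : List RawClause) (S : List Entry) : Prop where
  clauses : S.map (fun e => e.2.2) = l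
  length : ∀ e ∈ S, e.2.2.length = n
  nonempty : ∀ e ∈ S, ∃ i b, HasLit e.2.2 i b
  occ : ∀ e ∈ S, 0 < e.1 → occurs e.2.2 e.2.1 = true
  uniq : S.Pairwise fun e e' => 0 < e.1 → 0 < e'.1 → e.2.1 ≠ e'.2.1
  closed : ∀ e ∈ S, e.1 ≤ g → ∀ e' ∈ S, g < e'.1 → ∀ b, ¬HasLit e.2.2 e'.2.1 b
  owned : ∀ e ∈ S, e.1 ≤ g → ∀ i b, HasLit e.2.2 i b → i ∈ owners n S

/-- If the owner of a clause above the gap occurred in a clause below it, `near` would force the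
latter's price to equal the gap, which does not occur. A variable owning nothing occurs only at
prices of at least m + 1, whereas the gap is at most m. -/
theorem settled_auction {n : ℕ} {l : List RawClause} (hlen : ∀ c ∈ l, c.length = n)
    (hne : ∀ c ∈ l, ∃ i b, HasLit c i b) :
    Settled n (priceGap (auction n l)) l (auction n l) := by
  obtain ⟨hinv, hfix⟩ := auction_spec n l
  generalize auction n l = S at *
  obtain ⟨hg1, hg2⟩ := priceGap_spec S
  have hSl : S.length = l.length := by rw [← hinv.clauses, List.length_map]
  generalize priceGap S = g at *
  have hmem : ∀ e ∈ S, e.2.2 ∈ l := fun e he => by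
    rw [← hinv.clauses]; exact List.mem_map_of_mem he
  refine ⟨hinv.clauses, fun e he => hlen _ (hmem e he), fun e he => hne _ (hmem e he), hinv.occ,
    hinv.uniq, fun e he hle e' he' hlt b hb => ?_, fun e he hle i b hb => ?_⟩
  · have h1 := hinv.near e' he' e he (by omega) (occurs_iff.2 ⟨b, hb⟩)
    have h2 := hg2 e he
    omega
  · have hi : i < n := by rw [← hlen _ (hmem e he)]; exact hb.lt_length
    simp only [owners, List.mem_filter, List.mem_range, List.any_eq_true]
    refine ⟨hi, ?_⟩
    by_contra hno
    have h1 := le_price_of_bid_eq (hfix i hi) (fun e he => by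
      by_contra h
      exact hno ⟨e, he, by simpa using h⟩) e he (occurs_iff.2 ⟨b, hb⟩)
    omega

section
variable {n g : ℕ} {l : List RawClause} {S : List Entry}

theorem Settled.index_eq (h : Settled n g l S) {a b : ℕ} (ha : a < S.length) (hb : b < S.length)
    (h1 : 0 < S[a].1) (h2 : 0 < S[b].1) (h3 : S[a].2.1 = S[b].2.1) : a = b := by
  have h4 := List.pairwise_iff_getElem.1 h.uniq
  rcases lt_trichotomy a b with hab | hab | hab
  · exact (h4 a b ha hb hab h1 h2 h3).elim
  · exact hab
  · exact (h4 b a hb ha hab h2 h1 h3.symm).elim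

theorem Settled.entry_eq (h : Settled n g l S) {e e' : Entry} (he : e ∈ S) (he' : e' ∈ S)
    (h1 : 0 < e.1) (h2 : 0 < e'.1) (h3 : e.2.1 = e'.2.1) : e = e' := by
  obtain ⟨a, ha, rfl⟩ := List.getElem_of_mem he
  obtain ⟨b, hb, rfl⟩ := List.getElem_of_mem he'
  have := h.index_eq ha hb h1 h2 h3
  subst this
  rfl

theorem mem_owners {i : ℕ} : i ∈ owners n S ↔ i < n ∧ ∃ e ∈ S, 0 < e.1 ∧ e.2.1 = i := by
  simp only [owners, List.mem_filter, List.mem_range, List.any_eq_true, owns_iff]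

theorem owners_nodup : (owners n S).Nodup := List.nodup_range.filter _

theorem Settled.owner_mem (h : Settled n g l S) {e : Entry} (he : e ∈ S) (h0 : 0 < e.1) :
    e.2.1 ∈ owners n S := by
  refine mem_owners.2 ⟨?_, e, he, h0, rfl⟩
  obtain ⟨b, hb⟩ := occurs_iff.1 (h.occ e he h0)
  rw [← h.length e he]
  exact hb.lt_length

/-- Every variable of a kept literal owns a clause. -/
theorem Settled.mem_owners_of_kept (h : Settled n g l S) {e : Entry} (he : e ∈ S) {i : ℕ} {b : Bool}
    (hk : Kept g e i b) : i ∈ owners n S := by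
  by_cases hle : e.1 ≤ g
  · exact h.owned e he hle i b hk.hasLit
  · obtain ⟨d, hd⟩ := kept_of_gt (not_le.1 hle) (h.occ e he (by omega))
    rw [((hd i b).1 hk).1]
    exact h.owner_mem he (by omega)

theorem hasLit_keptClause {A : List ℕ} {e : Entry} {j : ℕ} {b : Bool} :
    HasLit (A.map (keptLits g e)) j b ↔ ∃ h : j < A.length, Kept g e A[j] b := hasLit_map

theorem Settled.exists_kept (h : Settled n g l S) {e : Entry} (he : e ∈ S) :
    ∃ i b, Kept g e i b := by
  by_cases hle : e.1 ≤ g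
  · obtain ⟨i, b, hb⟩ := h.nonempty e he
    exact ⟨i, b, (kept_of_le hle).2 hb⟩
  · obtain ⟨d, hd⟩ := kept_of_gt (not_le.1 hle) (h.occ e he (by omega))
    exact ⟨_, d, (hd _ _).2 ⟨rfl, rfl⟩⟩

theorem Settled.exists_hasLit (h : Settled n g l S) {e : Entry} (he : e ∈ S) :
    ∃ j b, HasLit ((owners n S).map (keptLits g e)) j b := by
  obtain ⟨i, b, hk⟩ := h.exists_kept he
  obtain ⟨j, hj, rfl⟩ := List.getElem_of_mem (h.mem_owners_of_kept he hk)
  exact ⟨j, b, hasLit_keptClause.2 ⟨hj, hk⟩⟩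

/-- A unit clause of the reduced formula has exactly one kept literal. -/
theorem Settled.unit_kept (h : Settled n g l S) {e : Entry} (he : e ∈ S) {j : ℕ} {b : Bool}
    (hu : IsUnitAt ((owners n S).map (keptLits g e)) j b) :
    ∃ hj : j < (owners n S).length, Kept g e (owners n S)[j] b ∧
      ∀ i d, Kept g e i d → i = (owners n S)[j] ∧ d = b := by
  obtain ⟨hj, hk⟩ := hasLit_keptClause.1 hu.1
  refine ⟨hj, hk, fun i d hd => ?_⟩
  obtain ⟨j', hj', rfl⟩ := List.getElem_of_mem (h.mem_owners_of_kept he hd)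
  obtain ⟨rfl, rfl⟩ := hu.2 j' d (hasLit_keptClause.2 ⟨hj', hd⟩)
  exact ⟨rfl, rfl⟩

/-- Clauses below the gap are unchanged, so no conflict arises among them. A clause above it keeps a
literal of its owner, which occurs in no clause below the gap and owns no other clause. -/
theorem Settled.conflictFree (h : Settled n g l S) (hl : ConflictFree l) :
    ConflictFree (S.map fun e => (owners n S).map (keptLits g e)) := by
  intro c hc c' hc'
  obtain ⟨e, he, rfl⟩ := List.mem_map.1 hc
  obtain ⟨e', he', rfl⟩ := List.mem_map.1 hc'
  by_contra hcon
  obtain ⟨j, b, h1, h2⟩ := conflict_iff.1 (by simpa using hcon)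
  obtain ⟨hj, hk, hk1⟩ := h.unit_kept he h1
  obtain ⟨_, hk', hk1'⟩ := h.unit_kept he' h2
  generalize (owners n S)[j] = i at *
  have hmem : ∀ e ∈ S, e.2.2 ∈ l := fun e he => by
    rw [← h.clauses]; exact List.mem_map_of_mem he
  have hgt : ∀ e ∈ S, ¬e.1 ≤ g → ∃ d, ∀ i b, Kept g e i b ↔ i = e.2.1 ∧ b = d :=
    fun e he hle => kept_of_gt (not_le.1 hle) (h.occ e he (by omega))
  by_cases hle : e.1 ≤ g <;> by_cases hle' : e'.1 ≤ g
  · have := hl _ (hmem e he) _ (hmem e' he')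
    rw [conflict_iff.2 ⟨i, b, ⟨hk.hasLit, fun j d hd => hk1 j d ((kept_of_le hle).2 hd)⟩,
      ⟨hk'.hasLit, fun j d hd => hk1' j d ((kept_of_le hle').2 hd)⟩⟩] at this
    simp at this
  · obtain ⟨d, hd⟩ := hgt e' he' hle'
    have h3 := ((hd _ _).1 hk').1
    exact h.closed e he hle e' he' (not_le.1 hle') b (h3 ▸ hk.hasLit)
  · obtain ⟨d, hd⟩ := hgt e he hle
    have h3 := ((hd _ _).1 hk).1
    exact h.closed e' he' hle' e he (not_le.1 hle) _ (h3 ▸ hk'.hasLit)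
  · obtain ⟨d, hd⟩ := hgt e he hle
    obtain ⟨d', hd'⟩ := hgt e' he' hle'
    have h3 := (hd _ _).1 hk
    have h4 := (hd' _ _).1 hk'
    have : e = e' := h.entry_eq he he' (by omega) (by omega) (h3.1.symm.trans h4.1)
    subst this
    have h5 := (hd _ _).1 hk'
    have : b = !b := h3.2.trans h5.2.symm
    cases b <;> simp at this

/-- Setting the owners of clauses above the gap to their kept literals satisfies all these clauses
and leaves those below untouched. Conversely, kept clauses are subclauses, so satisfying them
satisfies the originals. -/
theorem Settled.aboveHalf_iff (h : Settled n g l S) (k : ℕ) :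
    AboveHalf l k ↔ AboveHalf (S.map fun e => (owners n S).map (keptLits g e)) k := by
  classical
  have hgt : ∀ e ∈ S, ¬e.1 ≤ g → ∃ d, ∀ i b, Kept g e i b ↔ i = e.2.1 ∧ b = d :=
    fun e he hle => kept_of_gt (not_le.1 hle) (h.occ e he (by omega))
  unfold AboveHalf
  rw [← h.clauses]
  simp only [List.length_map, List.countP_map]
  constructor
  · rintro ⟨α, hα⟩
    obtain ⟨α', h1, h2⟩ : ∃ α' : ℕ → Bool,
        (∀ i, (∀ e ∈ S, g < e.1 → e.2.1 ≠ i) → α' i = α i) ∧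
        ∀ e ∈ S, g < e.1 → Kept g e e.2.1 (α' e.2.1) := by
      refine ⟨fun i => if ∃ e ∈ S, g < e.1 ∧ e.2.1 = i ∧ Kept g e i true then true else
        if ∃ e ∈ S, g < e.1 ∧ e.2.1 = i then false else α i, fun i hi => ?_, fun e he hlt => ?_⟩
      · simp only
        rw [if_neg, if_neg]
        · rintro ⟨e, he, h1, h2⟩; exact hi e he h1 h2
        · rintro ⟨e, he, h1, h2, _⟩; exact hi e he h1 h2
      · obtain ⟨d, hd⟩ := hgt e he (not_le.2 hlt)
        simp only
        split <;> rename_i hc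
        · obtain ⟨e', he', h1, h2, h3⟩ := hc
          have := h.entry_eq he' he (by omega) (by omega) h2
          rwa [this] at h3
        · rw [if_pos ⟨e, he, hlt, rfl⟩]
          have : ¬Kept g e e.2.1 true := fun hk => hc ⟨e, he, hlt, rfl, hk⟩
          rw [hd] at this ⊢
          refine ⟨rfl, ?_⟩
          cases d <;> simp at *
    refine ⟨fun j => α' ((owners n S).getD j 0), hα.trans ?_⟩
    gcongr
    refine List.countP_mono_left fun e he hsat => ?_
    simp only [Function.comp_apply, rawSat_iff] at *
    have key : ∃ i, Kept g e i (α' i) := by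
      by_cases hle : e.1 ≤ g
      · obtain ⟨i, hi⟩ := hsat
        refine ⟨i, (kept_of_le hle).2 ?_⟩
        rw [h1 i fun e' he' hlt heq => h.closed e he hle e' he' hlt (α i) (heq ▸ hi)]
        exact hi
      · exact ⟨_, h2 e he (not_le.1 hle)⟩
    obtain ⟨i, hk⟩ := key
    obtain ⟨j, hj, rfl⟩ := List.getElem_of_mem (h.mem_owners_of_kept he hk)
    refine ⟨j, hasLit_keptClause.2 ⟨hj, ?_⟩⟩
    simpa [hj] using hk
  · rintro ⟨α, hα⟩
    -- `idxOf` undoes the renumbering of owners; the value at other variables is irrelevant.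
    refine ⟨fun i => α ((owners n S).idxOf i), hα.trans ?_⟩
    gcongr
    refine List.countP_mono_left fun e he hsat => ?_
    simp only [Function.comp_apply, rawSat_iff] at *
    obtain ⟨j, hj⟩ := hsat
    obtain ⟨hj', hk⟩ := hasLit_keptClause.1 hj
    refine ⟨(owners n S)[j], ?_⟩
    rw [owners_nodup.idxOf_getElem]
    exact hk.hasLit

theorem Settled.exists_own (h : Settled n g l S) : ∃ own : Fin (owners n S).length → Fin S.length,
    own.Injective ∧ ∀ j, ∃ b, HasLit ((owners n S).map (keptLits g S[own j])) j b := by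
  have h1 : ∀ j : Fin (owners n S).length, ∃ a : Fin S.length, 0 < S[a].1 ∧ S[a].2.1 = (owners n S)[j] := by
    intro j
    obtain ⟨_, e, he, h0, h2⟩ := mem_owners.1 (List.getElem_mem (l := owners n S) j.2)
    obtain ⟨a, ha, rfl⟩ := List.getElem_of_mem he
    exact ⟨⟨a, ha⟩, h0, h2⟩
  choose own h0 hown using h1
  refine ⟨own, fun j j' hjj => ?_, fun j => ?_⟩
  · have h2 := (hown j).symm.trans (hjj ▸ hown j')
    exact Fin.ext ((owners_nodup.getElem_inj_iff).1 h2)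
  · have he : S[own j] ∈ S := List.getElem_mem (own j).2
    have hk : ∃ b, Kept g S[own j] (owners n S)[j] b := by
      rw [← hown j]
      by_cases hle : (S[own j]).1 ≤ g
      · obtain ⟨b, hb⟩ := occurs_iff.1 (h.occ _ he (h0 j))
        exact ⟨b, (kept_of_le hle).2 hb⟩
      · obtain ⟨d, hd⟩ := kept_of_gt (not_le.1 hle) (h.occ _ he (h0 j))
        exact ⟨d, (hd _ _).2 ⟨rfl, rfl⟩⟩
    obtain ⟨b, hb⟩ := hk
    exact ⟨b, hasLit_keptClause.2 ⟨j.2, hb⟩⟩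

end

/-! ### Formulas and their encodings -/

/-- A clause as a list. -/
def rawOf {n : ℕ} (c : Clause n) : RawClause :=
  (List.finRange n).map fun i => (decide ((i, true) ∈ c), decide ((i, false) ∈ c))

/-- The clause that a list stands for. -/
def toClause (n : ℕ) (c : RawClause) : Clause n :=
  Finset.univ.filter fun x => HasLit c x.1 x.2

theorem mem_toClause {n : ℕ} {c : RawClause} {x : Fin n × Bool} :
    x ∈ toClause n c ↔ HasLit c x.1 x.2 := by simp [toClause]

theorem length_rawOf {n : ℕ} (c : Clause n) : (rawOf c).length = n := by simp [rawOf]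

theorem hasLit_rawOf {n : ℕ} {c : Clause n} {i : ℕ} {b : Bool} :
    HasLit (rawOf c) i b ↔ ∃ h : i < n, (⟨i, h⟩, b) ∈ c := by
  constructor
  · intro h
    have hi : i < n := by simpa [rawOf] using h.lt_length
    refine ⟨hi, ?_⟩
    unfold HasLit at h
    have : lits (rawOf c) i = (decide ((⟨i, hi⟩, true) ∈ c), decide ((⟨i, hi⟩, false) ∈ c)) := by
      simp [lits, rawOf, hi]
    rw [this] at h
    cases b <;> simpa using h
  · rintro ⟨hi, h⟩
    unfold HasLit
    have : lits (rawOf c) i = (decide ((⟨i, hi⟩, true) ∈ c), decide ((⟨i, hi⟩, false) ∈ c)) := by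
      simp [lits, rawOf, hi]
    rw [this]
    cases b <;> simpa using h

theorem rawOf_toClause {n : ℕ} {d : RawClause} (h : d.length = n) : rawOf (toClause n d) = d := by
  refine List.ext_getElem (by rw [length_rawOf, h]) fun i h1 h2 => ?_
  have h3 : lits d i = d[i] := by simp [lits, h2]
  simp [rawOf, mem_toClause, HasLit, h3]

theorem rawSat_rawOf {n : ℕ} (α : ℕ → Bool) (c : Clause n) :
    rawSat α (rawOf c) = decide (CNF.Satisfies (fun i => α i) c) := by
  rw [Bool.eq_iff_iff, rawSat_iff, decide_eq_true_eq]
  constructor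
  · rintro ⟨i, hi⟩
    obtain ⟨h1, h2⟩ := hasLit_rawOf.1 hi
    exact ⟨_, h2, rfl⟩
  · rintro ⟨⟨i, b⟩, h1, h2⟩
    simp only at h2
    exact ⟨i, hasLit_rawOf.2 ⟨i.2, h2 ▸ h1⟩⟩

/-- A formula with its clauses as lists. -/
def CNF.raw (F : CNF) : List RawClause := F.clauses.map rawOf

open Enc in
-- As data, a formula and its list form coincide, so programs on lists are programs on formulas.
-- (The statement uses `Enc` for the list side.)
theorem encode_eq (F : CNF) : F.encode = enc (F.numVars, F.raw) := by
  simp only [CNF.encode, enc_pair, CNF.raw]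
  congr 1
  simp only [enc, List.map_map]
  congr 1
  refine List.map_congr_left fun c _ => ?_
  simp [CNF.encodeClause, rawOf, Function.comp_def]

theorem mem_SATAboveHalf (F : CNF) (k : ℕ) : (F, k) ∈ SATAboveHalf ↔ AboveHalf F.raw k := by
  have h1 : (F, k) ∈ SATAboveHalf ↔ F.numClauses + 2 * k ≤ 2 * F.sat := by
    simp only [SATAboveHalf, Set.mem_ofPred_eq]
    rw [← @Nat.cast_le ℝ]
    push_cast
    constructor <;> intro h <;> linarith
  rw [h1]
  have h2 : ∀ α : ℕ → Bool, F.raw.countP (rawSat α) = F.numSat fun i => α i := by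
    intro α
    simp only [CNF.raw, List.countP_map, CNF.numSat]
    congr 1
    funext c
    exact rawSat_rawOf α c
  have h3 : F.raw.length = F.numClauses := by simp [CNF.raw, CNF.numClauses]
  unfold AboveHalf
  simp only [h2, h3]
  constructor
  · intro h
    obtain ⟨α, _, hα⟩ := Finset.exists_mem_eq_sup Finset.univ Finset.univ_nonempty F.numSat
    refine ⟨fun i => if h : i < F.numVars then α ⟨i, h⟩ else false, ?_⟩
    have : (fun i : Fin F.numVars => (fun i => if h : i < F.numVars then α ⟨i, h⟩ else false) (i : ℕ))
        = α := by
      funext i; simp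
    simp only [this]
    rw [← hα]
    exact h
  · rintro ⟨α, hα⟩
    have : F.numSat (fun i => α i) ≤ F.sat := Finset.le_sup (f := F.numSat) (Finset.mem_univ _)
    omega

/-- The formula given by clauses stored as lists. -/
def ofRaw (n : ℕ) (l : List RawClause) (hlen : ∀ c ∈ l, c.length = n)
    (hne : ∀ c ∈ l, ∃ i b, HasLit c i b) : CNF where
  numVars := n
  clauses := l.map (toClause n)
  nonempty_of_mem := by
    intro c hc
    obtain ⟨d, hd, rfl⟩ := List.mem_map.1 hc
    obtain ⟨i, b, h⟩ := hne d hd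
    exact ⟨(⟨i, hlen d hd ▸ h.lt_length⟩, b), mem_toClause.2 h⟩

theorem raw_ofRaw (n : ℕ) (l : List RawClause) (hlen : ∀ c ∈ l, c.length = n)
    (hne : ∀ c ∈ l, ∃ i b, HasLit c i b) : (ofRaw n l hlen hne).raw = l := by
  simp only [CNF.raw, ofRaw, List.map_map]
  conv_rhs => rw [← List.map_id l]
  exact List.map_congr_left fun c hc => rawOf_toClause (hlen c hc)

end SATKernel

namespace SATKernel

open Polynomial
open Enc

/-! ### Size bounds for reduced formulas and assembly of the kernel. -/

theorem cappedVal_bits (N k : ℕ) : cappedVal N k.bits = min N k := by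
  rw [cappedVal, List.foldl_reverse]
  induction k using Nat.binaryRec' with
  | zero => simp
  | bit b n h ih =>
    rw [Nat.bits_append_bit n b h, List.foldr_cons, ih, Nat.bit_val]
    omega

theorem countP_eq_card {α : Type} (p : α → Bool) (l : List α) :
    l.countP p = (Finset.univ.filter fun a : Fin l.length => p l[a] = true).card := by
  have h : ∀ l : List α, l.countP p = (l.map fun x => if p x = true then 1 else 0).sum := by
    intro l
    induction l with
    | nil => rfl
    | cons a l ih => rw [List.countP_cons, ih, List.map_cons, List.sum_cons, add_comm]
  rw [h, Finset.card_filter, ← Fin.sum_univ_fun_getElem]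
  rfl

/-- A reduced formula: no conflicting unit clauses, and the variables own distinct clauses. -/
structure IsReduced (n : ℕ) (l : List RawClause) : Prop where
  length : ∀ c ∈ l, c.length = n
  nonempty : ∀ c ∈ l, ∃ i b, HasLit c i b
  conflictFree : ConflictFree l
  own : ∃ own : Fin n → Fin l.length, own.Injective ∧ ∀ j, ∃ b, HasLit l[own j] j b

theorem reduceOwned_spec {n : ℕ} {l : List RawClause} (hlen : ∀ c ∈ l, c.length = n)
    (hne : ∀ c ∈ l, ∃ i b, HasLit c i b) (hl : ConflictFree l) :
    IsReduced (reduceOwned n l).1 (reduceOwned n l).2 ∧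
    ∀ k, AboveHalf l k ↔ AboveHalf (reduceOwned n l).2 k := by
  have h := settled_auction hlen hne
  unfold reduceOwned
  refine ⟨⟨fun c hc => ?_, fun c hc => ?_, h.conflictFree hl, ?_⟩, h.aboveHalf_iff⟩
  · obtain ⟨e, _, rfl⟩ := List.mem_map.1 hc
    simp
  · obtain ⟨e, he, rfl⟩ := List.mem_map.1 hc
    exact h.exists_hasLit he
  · obtain ⟨own, h1, h2⟩ := h.exists_own
    refine ⟨fun j => Fin.cast (by simp) (own j), fun j j' hj => h1 (by simpa [Fin.ext_iff] using hj),
      fun j => ?_⟩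
    obtain ⟨b, hb⟩ := h2 j
    exact ⟨b, by simpa using hb⟩

section
variable {n : ℕ} {l : List RawClause}

/-- The clauses of a formula without conflicting unit clauses contain no complementary pair of
unit clauses. -/
theorem IsReduced.not_complementary (h : IsReduced n l) (a b : Fin l.length) (i : Fin n)
    (ha : toClause n l[a] = {(i, true)}) : toClause n l[b] ≠ {(i, false)} := by
  intro hb
  have key : ∀ (a : Fin l.length) (d : Bool), toClause n l[a] = {(i, d)} → IsUnitAt l[a] i d := by
    intro a d ha
    have hm : ∀ x, HasLit l[a] x.1 x.2 ↔ x = (i, d) := fun x => by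
      rw [← mem_toClause, ha, Finset.mem_singleton]
    refine ⟨(hm (i, d)).2 rfl, fun j e hj => ?_⟩
    have hjn : j < n := by
      rw [← h.length l[a] (List.getElem_mem a.2)]
      exact hj.lt_length
    have := (hm (⟨j, hjn⟩, e)).1 hj
    rw [Prod.ext_iff, Fin.ext_iff] at this
    exact this
  have h1 := h.conflictFree _ (List.getElem_mem a.2) _ (List.getElem_mem b.2)
  have h2 : conflict l[a] l[b] = true := conflict_iff.2 ⟨i, true, key a true ha, key b false hb⟩
  exact absurd (h1.symm.trans h2) (by simp)

theorem IsReduced.nonempty_toClause (h : IsReduced n l) (a : Fin l.length) :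
    (toClause n l[a]).Nonempty := by
  obtain ⟨i, b, hi⟩ := h.nonempty l[a] (List.getElem_mem a.2)
  have : i < n := by
    rw [← h.length l[a] (List.getElem_mem a.2)]
    exact hi.lt_length
  exact ⟨(⟨i, this⟩, b), mem_toClause.2 hi⟩

theorem IsReduced.exists_countP_eq (h : IsReduced n l) (α : Fin n → Bool) :
    ∃ α' : ℕ → Bool, l.countP (rawSat α') =
      (Finset.univ.filter fun a : Fin l.length => CNF.Satisfies α (toClause n l[a])).card := by
  refine ⟨fun i => if h : i < n then α ⟨i, h⟩ else false, ?_⟩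
  rw [countP_eq_card]
  congr 1
  refine Finset.filter_congr fun a _ => ?_
  have h1 := rawOf_toClause (h.length l[a] (List.getElem_mem a.2))
  conv_lhs => rw [← h1]
  rw [rawSat_rawOf, decide_eq_true_eq]
  simp

theorem IsReduced.aboveHalf_of_lt_vars (h : IsReduced n l) {k : ℕ} (hk : 4 * k < n) :
    AboveHalf l k := by
  obtain ⟨own, h1, h2⟩ := h.own
  obtain ⟨α, hα⟩ := two_mul_card_add_le (fun a : Fin l.length => toClause n l[a])
    h.nonempty_toClause h.not_complementary own h1 fun i => by
      obtain ⟨b, hb⟩ := h2 i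
      exact ⟨b, mem_toClause.2 hb⟩
  obtain ⟨α', hα'⟩ := h.exists_countP_eq α
  refine ⟨α', ?_⟩
  rw [hα']
  rw [Fintype.card_fin] at hα
  omega

theorem IsReduced.aboveHalf_of_lt_clauses (h : IsReduced n l) {k : ℕ}
    (hk : (2 * Real.sqrt 5 + 4) * k < l.length) : AboveHalf l k := by
  obtain ⟨α, hα⟩ := golden_mul_card_le (fun a : Fin l.length => toClause n l[a])
    h.nonempty_toClause h.not_complementary
  obtain ⟨α', hα'⟩ := h.exists_countP_eq α
  refine ⟨α', ?_⟩
  rw [← hα', Fintype.card_fin] at hα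
  have h5 : Real.sqrt 5 ^ 2 = 5 := Real.sq_sqrt (by norm_num)
  have h5' : 2 < Real.sqrt 5 := Real.lt_sqrt_of_sq_lt (by norm_num)
  -- The surplus of (√5 − 1)/2 over 1/2 is (√5 − 2)/2, and (√5 − 2)(2√5 + 4) = 2; this is the origin
  -- of the constant 2√5 + 4.
  have h1 := mul_lt_mul_of_pos_left hk (sub_pos.2 h5')
  have h2 : (Real.sqrt 5 - 2) * ((2 * Real.sqrt 5 + 4) * k) = 2 * k := by
    linear_combination (2 * (k : ℝ)) * h5
  rw [h2] at h1
  rw [← @Nat.cast_le ℝ]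
  push_cast
  linarith

end

/-- Squaring m − 4k ≤ 2√5·k gives a test in integers; truncated subtraction makes it succeed when m
≤ 4k. -/
theorem fits_iff {k : ℕ} {F : ℕ × List RawClause} : fits k F = true ↔
    F.1 ≤ 4 * k ∧ (F.2.length : ℝ) ≤ (2 * Real.sqrt 5 + 4) * k := by
  simp only [fits, Bool.and_eq_true, decide_eq_true_eq]
  refine and_congr_right fun _ => ?_
  generalize F.2.length = m
  have h5 : Real.sqrt 5 ^ 2 = 5 := Real.sq_sqrt (by norm_num)
  have h0 : 0 ≤ 2 * Real.sqrt 5 * k := by positivity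
  rcases le_total m (4 * k) with h | h
  · have h1 : (m : ℝ) ≤ 4 * k := by exact_mod_cast h
    simp only [Nat.sub_eq_zero_of_le h, zero_mul, zero_le, true_iff]
    linarith
  · obtain ⟨d, rfl⟩ := Nat.exists_eq_add_of_le h
    rw [Nat.add_sub_cancel_left]
    have h1 : d * d ≤ 20 * (k * k) ↔ (d : ℝ) ^ 2 ≤ (2 * Real.sqrt 5 * k) ^ 2 := by
      rw [← @Nat.cast_le ℝ]
      push_cast
      have : (2 * Real.sqrt 5 * (k : ℝ)) ^ 2 = 20 * (k * k) := by
        linear_combination (4 * (k : ℝ) ^ 2) * h5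
      rw [this, sq]
    rw [h1, sq_le_sq₀ (by positivity) h0]
    push_cast
    constructor <;> intro h <;> linarith

theorem encodeParam_eq (x : CNF × ℕ) :
    encodeParam CNF.encode x = enc ((x.1.numVars, x.1.raw), x.2.bits) := by
  rw [encodeParam, encode_eq]
  rfl

theorem length_of_mem_raw {F : CNF} {c : RawClause} (hc : c ∈ F.raw) : c.length = F.numVars := by
  obtain ⟨d, _, rfl⟩ := List.mem_map.1 hc
  exact length_rawOf d

theorem hasLit_of_mem_raw {F : CNF} {c : RawClause} (hc : c ∈ F.raw) : ∃ i b, HasLit c i b := by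
  obtain ⟨d, hd, rfl⟩ := List.mem_map.1 hc
  obtain ⟨⟨i, b⟩, h⟩ := F.nonempty_of_mem d hd
  exact ⟨i, b, hasLit_rawOf.2 ⟨i.2, h⟩⟩

theorem esize_rawClause_le (c : RawClause) : esize c ≤ 8 * c.length + 1 := by
  induction c with
  | nil => simp
  | cons p c ih =>
    have h1 := esize_bool p.1
    have h2 := esize_bool p.2
    have h3 : esize p = esize p.1 + esize p.2 + 1 := rfl
    simp only [esize_cons, List.length_cons]
    omega

theorem size_encode_le (F : CNF) :
    F.encode.size ≤ 2 * F.numVars + F.numClauses * (8 * F.numVars + 2) + 3 := by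
  rw [encode_eq]
  change esize (F.numVars, F.raw) ≤ _
  have h : ∀ l : List RawClause, (∀ c ∈ l, c.length = F.numVars) →
      esize l ≤ l.length * (8 * F.numVars + 2) + 1 := by
    intro l
    induction l with
    | nil => simp
    | cons c l ih =>
      intro hl
      have h1 := ih fun d hd => hl d (List.mem_cons_of_mem _ hd)
      have h2 := esize_rawClause_le c
      rw [hl c List.mem_cons_self] at h2
      rw [esize_cons, List.length_cons, Nat.succ_mul]
      omega
  have h1 := h F.raw fun c hc => length_of_mem_raw hc
  have h2 : F.raw.length = F.numClauses := by simp [CNF.raw, CNF.numClauses]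
  rw [h2] at h1
  simp only [esize_pair, esize_nat]
  omega

theorem sqrt_five_bound (k : ℕ) : (2 * Real.sqrt 5 + 4) * (k : ℝ) ≤ 8.473 * (k : ℝ) := by
  have : Real.sqrt 5 ≤ 2.2365 := Real.sqrt_le_iff.2 ⟨by norm_num, by norm_num⟩
  gcongr
  linarith

/-- The program only produces data; this supplies a formula with that encoding, from which the
kernelization is chosen. It is the reduced formula if that fits, and otherwise an empty formula
serving as a fixed yes- or no-instance. -/
theorem exists_kernel_instance (x : CNF × ℕ) : ∃ y : CNF × ℕ,
    encodeParam CNF.encode y = enc (kernel ((x.1.numVars, x.1.raw), x.2.bits)) ∧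
    (x ∈ SATAboveHalf ↔ y ∈ SATAboveHalf) ∧ y.2 ≤ x.2 ∧ y.1.numVars ≤ 4 * x.2 ∧
    (y.1.numClauses : ℝ) ≤ (2 * Real.sqrt 5 + 4) * x.2 := by
  obtain ⟨F, k⟩ := x
  obtain ⟨hc1, hc2, hc3⟩ := cancelUnits_spec F.raw
  obtain ⟨hr, hiff⟩ := reduceOwned_spec (n := F.numVars) (fun c hc => length_of_mem_raw (hc2 c hc))
    (fun c hc => hasLit_of_mem_raw (hc2 c hc)) hc1
  have hyes : (F, k) ∈ SATAboveHalf ↔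
      AboveHalf (reduceOwned F.numVars (cancelUnits F.raw)).2 k := by
    rw [mem_SATAboveHalf, hc3, hiff]
  have hraw0 := raw_ofRaw 0 [] (by simp) (by simp)
  have hbound : (0 : ℝ) ≤ (2 * Real.sqrt 5 + 4) * k := by positivity
  have hcap : cappedVal (F.raw.length + 1) k.bits ≤ F.raw.length ↔ k ≤ F.raw.length := by
    rw [cappedVal_bits]; omega
  simp only
  by_cases hk : k ≤ F.raw.length
  · have hcap' : cappedVal (F.raw.length + 1) k.bits = k := by rw [cappedVal_bits]; omega
    by_cases hf : fits k (reduceOwned F.numVars (cancelUnits F.raw)) = true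
    · have hraw := raw_ofRaw _ _ hr.length hr.nonempty
      obtain ⟨h1, h2⟩ := fits_iff.1 hf
      refine ⟨(ofRaw _ _ hr.length hr.nonempty, k), ?_, ?_, le_rfl, h1, ?_⟩
      · rw [encodeParam_eq]
        simp only [kernel, hcap', hk, hf, decide_true, if_true, hraw]
        rfl
      · rw [hyes, mem_SATAboveHalf, hraw]
      · simpa [CNF.numClauses, ofRaw] using h2
    · refine ⟨(ofRaw 0 [] (by simp) (by simp), 0), ?_, ?_, Nat.zero_le _, Nat.zero_le _, ?_⟩
      · rw [encodeParam_eq]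
        simp only [kernel, hcap', hk, hf, decide_true, if_true, hraw0, Nat.zero_bits]
        rfl
      · rw [hyes, mem_SATAboveHalf, hraw0]
        refine iff_of_true ?_ ⟨fun _ => false, by simp⟩
        rw [fits_iff, not_and_or, not_le, not_le] at hf
        rcases hf with hf | hf
        · exact hr.aboveHalf_of_lt_vars hf
        · exact hr.aboveHalf_of_lt_clauses hf
      · simpa [CNF.numClauses, ofRaw] using hbound
  -- The empty formula with parameter 1 is a no-instance, and 1 ≤ k since k exceeds the number of
  -- clauses.
  · refine ⟨(ofRaw 0 [] (by simp) (by simp), 1), ?_, ?_, by simp only; omega, Nat.zero_le _, ?_⟩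
    · rw [encodeParam_eq]
      simp only [kernel, hcap, hk, decide_false, Bool.false_eq_true, if_false, hraw0, Nat.one_bits]
      rfl
    · rw [mem_SATAboveHalf, mem_SATAboveHalf, hraw0]
      refine iff_of_false ?_ ?_
      · rintro ⟨α, hα⟩
        have := List.countP_le_length (p := rawSat α) (l := F.raw)
        omega
      · rintro ⟨α, hα⟩
        simp at hα
    · simpa [CNF.numClauses, ofRaw] using hbound

end SATKernel

theorem mainTheorem5 :
    (∃ κ : SATKernel.CNF × ℕ → SATKernel.CNF × ℕ,
      SATKernel.IsProperKernelization SATKernel.CNF.encode SATKernel.SATAboveHalf κ ∧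
      ∀ (F : SATKernel.CNF) (k : ℕ),
        (κ (F, k)).1.numVars ≤ 4 * k ∧
        ((κ (F, k)).1.numClauses : ℝ) ≤ (2 * Real.sqrt 5 + 4) * (k : ℝ)) ∧
    (∀ k : ℕ, (2 * Real.sqrt 5 + 4) * (k : ℝ) ≤ 8.473 * (k : ℝ)) := by
  refine ⟨?_, SATKernel.sqrt_five_bound⟩
  choose κ henc hyes hk hvars hclauses using SATKernel.exists_kernel_instance
  -- The size function is `size_encode_le` evaluated at 4k variables and 9k ≥ 8.473k clauses.
  refine ⟨κ, ⟨?_, hyes, hk, fun k => 8 * k + 9 * k * (32 * k + 2) + 3, fun x => ?_⟩,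
    fun F k => ⟨hvars (F, k), hclauses (F, k)⟩⟩
  · obtain ⟨p, P, h⟩ := SATKernel.PT.kernel
    refine ⟨p, P, fun x => ?_⟩
    rw [henc, SATKernel.encodeParam_eq]
    exact h _
  · have h1 := SATKernel.size_encode_le (κ x).1
    have h2 := hvars x
    have h3 : (κ x).1.numClauses ≤ 9 * x.2 := by
      have h4 := (hclauses x).trans (SATKernel.sqrt_five_bound x.2)
      have h5 : (8.473 : ℝ) * x.2 ≤ 9 * x.2 := by gcongr; norm_num
      exact_mod_cast h4.trans h5
    refine h1.trans ?_
    have h6 : (κ x).1.numClauses * (8 * (κ x).1.numVars + 2) ≤ 9 * x.2 * (32 * x.2 + 2) :=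
      Nat.mul_le_mul h3 (by omega)
    simp only
    omega
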